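/- Work in intuitionistic higher-order logic with natural numbers, function and proposition extensionality, and unique choice. Let $\Omega$ be the set of truth values and $\Sigma=\{p\in\Omega \mid \exists f\in 2^{\mathbb N}\,(p\Leftrightarrow\exists n\in\mathbb N\; f(n)=1)\}$ the set of semidecidable truth values; $\Sigma^X$ is the set of semidecidable subsets of $X$, identified with the maps $X\to\Sigma$. *Synthetic computability* is the theory with the following axioms: - Dependent Choice (for subsets of each type); - Markov principle: if not all terms of a binary sequence are $0$, then some term is $1$; - Enumerability Axiom: there is a surjection $W:\mathbb N\to\Sigma^{\mathbb N}$ (equivalently, there are countably many countable subsets of $\mathbb N$); - Stable Subspace Axiom: if $X\subseteq\mathbb N$ is stable, i.e. $\neg\neg(n\in X)\Rightarrow n\in X$ for all $n$, then every $S\in\Sigma^X$ is the restriction to $X$ of some $T\in\Sigma^{\mathbb N}$. An injective map $i:X\to Y$ is an *intrinsic inclusion* if for every $S:X\to\Sigma$ there is $T:Y\to\Sigma$ with $T(i(x))=S(x)$ for all $x\in X$. It is a *weak intrinsic inclusion* if for every $S:X\to\Sigma$ there is a multivalued map $\overline S:Y\rightrightarrows\Sigma$, that is, a map assigning to each $y\in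 Y$ an inhabited subset $\overline S(y)\subseteq\Sigma$, such that $\overline S(i(x))=\{S(x)\}$ for all $x\in X$. **Proposition.** The following is provable in synthetic computability. The map $i:\mathbb N^{\mathbb N}\to\Sigma^{\mathbb N\times\mathbb N}$ from Baire space given by $i(\alpha)=\{(n,\alpha(n))\mid n\in\mathbb N\}$ is a weak intrinsic inclusion (in particular, it is injective and its values are semidecidable), and it is not an intrinsic inclusion. -/

import Mathlib

/-!
Synthetic computability is a theory in intuitionistic higher-order logic that is refuted by
classical logic, so it cannot be assumed inside Lean.  We therefore define the logic itself
(simple types over the natural numbers and the truth values, terms, natural deduction), the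
theory, and the notion of a sentence being derivable from it.
-/

namespace SynthComp

/-! ### Types and terms of higher-order logic -/

/-- Simple types: natural numbers, truth values, binary products, and function types. -/
inductive Ty : Type
  | nat : Ty
  | omega : Ty
  | prod : Ty → Ty → Ty
  | arr : Ty → Ty → Ty

/-- A context lists the types of the free variables, the most recently bound one first. -/
abbrev Ctx : Type := List Ty

/-- `Var Γ A` is the type of (de Bruijn) variables of type `A` in the context `Γ`. -/
inductive Var : Ctx → Ty → Type
  | here {Γ : Ctx} {A : Ty} : Var (A :: Γ) A
  | there {Γ : Ctx} {A B : Ty} : Var Γ A → Var (B :: Γ) A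

/-- Well-typed terms in context.  Terms of type `Ty.omega` are the formulas. -/
inductive Tm : Ctx → Ty → Type
  | var {Γ : Ctx} {A : Ty} : Var Γ A → Tm Γ A
  | lam {Γ : Ctx} {B : Ty} (A : Ty) : Tm (A :: Γ) B → Tm Γ (Ty.arr A B)
  | app {Γ : Ctx} {A B : Ty} : Tm Γ (Ty.arr A B) → Tm Γ A → Tm Γ B
  | pair {Γ : Ctx} {A B : Ty} : Tm Γ A → Tm Γ B → Tm Γ (Ty.prod A B)
  | fst {Γ : Ctx} {A B : Ty} : Tm Γ (Ty.prod A B) → Tm Γ A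
  | snd {Γ : Ctx} {A B : Ty} : Tm Γ (Ty.prod A B) → Tm Γ B
  | zero {Γ : Ctx} : Tm Γ Ty.nat
  | succ {Γ : Ctx} : Tm Γ Ty.nat → Tm Γ Ty.nat
  | natrec {Γ : Ctx} {A : Ty} :
      Tm Γ A → Tm Γ (Ty.arr Ty.nat (Ty.arr A A)) → Tm Γ Ty.nat → Tm Γ A
  | eq {Γ : Ctx} {A : Ty} : Tm Γ A → Tm Γ A → Tm Γ Ty.omega
  | fls {Γ : Ctx} : Tm Γ Ty.omega
  | and {Γ : Ctx} : Tm Γ Ty.omega → Tm Γ Ty.omega → Tm Γ Ty.omega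
  | or {Γ : Ctx} : Tm Γ Ty.omega → Tm Γ Ty.omega → Tm Γ Ty.omega
  | imp {Γ : Ctx} : Tm Γ Ty.omega → Tm Γ Ty.omega → Tm Γ Ty.omega
  | all {Γ : Ctx} (A : Ty) : Tm (A :: Γ) Ty.omega → Tm Γ Ty.omega
  | ex {Γ : Ctx} (A : Ty) : Tm (A :: Γ) Ty.omega → Tm Γ Ty.omega

/-! ### Renaming and substitution -/

/-- Renamings of variables. -/
abbrev Ren (Γ Δ : Ctx) : Type := ∀ A : Ty, Var Γ A → Var Δ A

/-- Extend a renaming under a binder. -/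
def Ren.lift {Γ Δ : Ctx} (B : Ty) (r : Ren Γ Δ) : Ren (B :: Γ) (B :: Δ)
  | _, Var.here => Var.here
  | _, Var.there x => Var.there (r _ x)

/-- Apply a renaming to a term. -/
def Tm.ren {Γ : Ctx} {A : Ty} (t : Tm Γ A) : {Δ : Ctx} → Ren Γ Δ → Tm Δ A :=
  match t with
  | Tm.var x => fun r => Tm.var (r _ x)
  | Tm.lam C b => fun r => Tm.lam C (b.ren (r.lift C))
  | Tm.app f a => fun r => Tm.app (f.ren r) (a.ren r)
  | Tm.pair a b => fun r => Tm.pair (a.ren r) (b.ren r)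
  | Tm.fst a => fun r => Tm.fst (a.ren r)
  | Tm.snd a => fun r => Tm.snd (a.ren r)
  | Tm.zero => fun _ => Tm.zero
  | Tm.succ a => fun r => Tm.succ (a.ren r)
  | Tm.natrec a f n => fun r => Tm.natrec (a.ren r) (f.ren r) (n.ren r)
  | Tm.eq a b => fun r => Tm.eq (a.ren r) (b.ren r)
  | Tm.fls => fun _ => Tm.fls
  | Tm.and p q => fun r => Tm.and (p.ren r) (q.ren r)
  | Tm.or p q => fun r => Tm.or (p.ren r) (q.ren r)
  | Tm.imp p q => fun r => Tm.imp (p.ren r) (q.ren r)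
  | Tm.all C p => fun r => Tm.all C (p.ren (r.lift C))
  | Tm.ex C p => fun r => Tm.ex C (p.ren (r.lift C))

/-- Weakening: regard a term as a term in a context with one more variable. -/
def Tm.wk {Γ : Ctx} {A B : Ty} (t : Tm Γ A) : Tm (B :: Γ) A :=
  t.ren (fun _ x => Var.there x)

/-- Simultaneous substitutions. -/
abbrev Sub (Γ Δ : Ctx) : Type := ∀ A : Ty, Var Γ A → Tm Δ A

/-- Extend a substitution under a binder. -/
def Sub.lift {Γ Δ : Ctx} (B : Ty) (s : Sub Γ Δ) : Sub (B :: Γ) (B :: Δ)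
  | _, Var.here => Tm.var Var.here
  | _, Var.there x => (s _ x).wk

/-- Apply a (capture-avoiding) substitution to a term. -/
def Tm.sub {Γ : Ctx} {A : Ty} (t : Tm Γ A) : {Δ : Ctx} → Sub Γ Δ → Tm Δ A :=
  match t with
  | Tm.var x => fun s => s _ x
  | Tm.lam C b => fun s => Tm.lam C (b.sub (s.lift C))
  | Tm.app f a => fun s => Tm.app (f.sub s) (a.sub s)
  | Tm.pair a b => fun s => Tm.pair (a.sub s) (b.sub s)
  | Tm.fst a => fun s => Tm.fst (a.sub s)
  | Tm.snd a => fun s => Tm.snd (a.sub s)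
  | Tm.zero => fun _ => Tm.zero
  | Tm.succ a => fun s => Tm.succ (a.sub s)
  | Tm.natrec a f n => fun s => Tm.natrec (a.sub s) (f.sub s) (n.sub s)
  | Tm.eq a b => fun s => Tm.eq (a.sub s) (b.sub s)
  | Tm.fls => fun _ => Tm.fls
  | Tm.and p q => fun s => Tm.and (p.sub s) (q.sub s)
  | Tm.or p q => fun s => Tm.or (p.sub s) (q.sub s)
  | Tm.imp p q => fun s => Tm.imp (p.sub s) (q.sub s)
  | Tm.all C p => fun s => Tm.all C (p.sub (s.lift C))
  | Tm.ex C p => fun s => Tm.ex C (p.sub (s.lift C))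

/-- The substitution that replaces the last variable by `t` and fixes the others. -/
def Sub.single {Γ : Ctx} {A : Ty} (t : Tm Γ A) : Sub (A :: Γ) Γ
  | _, Var.here => t
  | _, Var.there x => Tm.var x

/-- `b.inst t` is `b` with the last variable replaced by `t`. -/
def Tm.inst {Γ : Ctx} {A B : Ty} (b : Tm (A :: Γ) B) (t : Tm Γ A) : Tm Γ B :=
  b.sub (Sub.single t)

/-! ### Notation and abbreviations -/

infixr:65 " ⇾ " => Ty.arr
infixl:90 " ⬝ " => Tm.app
infix:50 " ≐ " => Tm.eq
infixr:35 " ⋏ " => Tm.and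
infixr:30 " ⋎ " => Tm.or
infixr:25 " ⇛ " => Tm.imp

/-- Bi-implication. -/
def Tm.iff {Γ : Ctx} (p q : Tm Γ Ty.omega) : Tm Γ Ty.omega := (p ⇛ q) ⋏ (q ⇛ p)

/-- Negation. -/
def Tm.neg {Γ : Ctx} (p : Tm Γ Ty.omega) : Tm Γ Ty.omega := p ⇛ Tm.fls

/-- The numeral one. -/
def Tm.one {Γ : Ctx} : Tm Γ Ty.nat := Tm.succ Tm.zero

/-- The most recently bound variable. -/
def v0 {Γ : Ctx} {A : Ty} : Tm (A :: Γ) A := Tm.var Var.here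
/-- The variable bound before `v0`. -/
def v1 {Γ : Ctx} {A B : Ty} : Tm (B :: A :: Γ) A := Tm.var (Var.there Var.here)
/-- The variable bound before `v1`. -/
def v2 {Γ : Ctx} {A B C : Ty} : Tm (C :: B :: A :: Γ) A :=
  Tm.var (Var.there (Var.there Var.here))
/-- The variable bound before `v2`. -/
def v3 {Γ : Ctx} {A B C D : Ty} : Tm (D :: C :: B :: A :: Γ) A :=
  Tm.var (Var.there (Var.there (Var.there Var.here)))

/-- The variable bound before `v3`. -/
def v4 {Γ : Ctx} {A B C D E : Ty} : Tm (E :: D :: C :: B :: A :: Γ) A :=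
  Tm.var (Var.there (Var.there (Var.there (Var.there Var.here))))

/-! ### Intuitionistic natural deduction -/

/-- `Derives H φ`: the formula `φ` is derivable from the hypotheses `H` (all in the context `Γ`)
in intuitionistic higher-order logic, with function and proposition extensionality, the
axiom of unique choice (functional total relations are functions), and the natural numbers. -/
inductive Derives : {Γ : Ctx} → List (Tm Γ Ty.omega) → Tm Γ Ty.omega → Prop
  | hyp {Γ : Ctx} {H : List (Tm Γ Ty.omega)} {p : Tm Γ Ty.omega} : p ∈ H → Derives H p
  -- propositional connectives
  | fls_elim {Γ : Ctx} {H : List (Tm Γ Ty.omega)} {p : Tm Γ Ty.omega} :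
      Derives H Tm.fls → Derives H p
  | and_intro {Γ : Ctx} {H : List (Tm Γ Ty.omega)} {p q : Tm Γ Ty.omega} :
      Derives H p → Derives H q → Derives H (p ⋏ q)
  | and_left {Γ : Ctx} {H : List (Tm Γ Ty.omega)} {p q : Tm Γ Ty.omega} :
      Derives H (p ⋏ q) → Derives H p
  | and_right {Γ : Ctx} {H : List (Tm Γ Ty.omega)} {p q : Tm Γ Ty.omega} :
      Derives H (p ⋏ q) → Derives H q
  | or_inl {Γ : Ctx} {H : List (Tm Γ Ty.omega)} {p q : Tm Γ Ty.omega} :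
      Derives H p → Derives H (p ⋎ q)
  | or_inr {Γ : Ctx} {H : List (Tm Γ Ty.omega)} {p q : Tm Γ Ty.omega} :
      Derives H q → Derives H (p ⋎ q)
  | or_elim {Γ : Ctx} {H : List (Tm Γ Ty.omega)} {p q r : Tm Γ Ty.omega} :
      Derives H (p ⋎ q) → Derives (p :: H) r → Derives (q :: H) r → Derives H r
  | imp_intro {Γ : Ctx} {H : List (Tm Γ Ty.omega)} {p q : Tm Γ Ty.omega} :
      Derives (p :: H) q → Derives H (p ⇛ q)
  | imp_elim {Γ : Ctx} {H : List (Tm Γ Ty.omega)} {p q : Tm Γ Ty.omega} :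
      Derives H (p ⇛ q) → Derives H p → Derives H q
  -- quantifiers
  | all_intro {Γ : Ctx} {H : List (Tm Γ Ty.omega)} {A : Ty} {p : Tm (A :: Γ) Ty.omega} :
      Derives (H.map Tm.wk) p → Derives H (Tm.all A p)
  | all_elim {Γ : Ctx} {H : List (Tm Γ Ty.omega)} {A : Ty} {p : Tm (A :: Γ) Ty.omega}
      (t : Tm Γ A) : Derives H (Tm.all A p) → Derives H (p.inst t)
  | ex_intro {Γ : Ctx} {H : List (Tm Γ Ty.omega)} {A : Ty} {p : Tm (A :: Γ) Ty.omega}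
      (t : Tm Γ A) : Derives H (p.inst t) → Derives H (Tm.ex A p)
  | ex_elim {Γ : Ctx} {H : List (Tm Γ Ty.omega)} {A : Ty} {p : Tm (A :: Γ) Ty.omega}
      {q : Tm Γ Ty.omega} :
      Derives H (Tm.ex A p) → Derives (p :: H.map Tm.wk) q.wk → Derives H q
  -- equality and extensionality
  | eq_refl {Γ : Ctx} {H : List (Tm Γ Ty.omega)} {A : Ty} (t : Tm Γ A) : Derives H (t ≐ t)
  | eq_subst {Γ : Ctx} {H : List (Tm Γ Ty.omega)} {A : Ty} {s t : Tm Γ A}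
      (p : Tm (A :: Γ) Ty.omega) :
      Derives H (s ≐ t) → Derives H (p.inst s) → Derives H (p.inst t)
  | prop_ext {Γ : Ctx} {H : List (Tm Γ Ty.omega)} {p q : Tm Γ Ty.omega} :
      Derives H (p ⇛ q) → Derives H (q ⇛ p) → Derives H (p ≐ q)
  | fun_ext {Γ : Ctx} {H : List (Tm Γ Ty.omega)} {A B : Ty} {f g : Tm Γ (A ⇾ B)} :
      Derives H (Tm.all A (f.wk ⬝ v0 ≐ g.wk ⬝ v0)) → Derives H (f ≐ g)
  -- computation rules for functions and pairs
  | beta {Γ : Ctx} {H : List (Tm Γ Ty.omega)} {A B : Ty} (b : Tm (A :: Γ) B) (t : Tm Γ A) :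
      Derives H (Tm.lam A b ⬝ t ≐ b.inst t)
  | fst_pair {Γ : Ctx} {H : List (Tm Γ Ty.omega)} {A B : Ty} (a : Tm Γ A) (b : Tm Γ B) :
      Derives H (Tm.fst (Tm.pair a b) ≐ a)
  | snd_pair {Γ : Ctx} {H : List (Tm Γ Ty.omega)} {A B : Ty} (a : Tm Γ A) (b : Tm Γ B) :
      Derives H (Tm.snd (Tm.pair a b) ≐ b)
  | pair_eta {Γ : Ctx} {H : List (Tm Γ Ty.omega)} {A B : Ty} (t : Tm Γ (Ty.prod A B)) :
      Derives H (Tm.pair (Tm.fst t) (Tm.snd t) ≐ t)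
  -- unique choice
  | unique_choice {Γ : Ctx} {H : List (Tm Γ Ty.omega)} {A B : Ty}
      (R : Tm Γ (A ⇾ B ⇾ Ty.omega)) :
      Derives H (Tm.all A (Tm.ex B (R.wk.wk ⬝ v1 ⬝ v0 ⋏
        Tm.all B (R.wk.wk.wk ⬝ v2 ⬝ v0 ⇛ v0 ≐ v1)))) →
      Derives H (Tm.ex (A ⇾ B) (Tm.all A (R.wk.wk ⬝ v0 ⬝ (v1 ⬝ v0))))
  -- natural numbers
  | succ_ne_zero {Γ : Ctx} {H : List (Tm Γ Ty.omega)} (t : Tm Γ Ty.nat) :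
      Derives H (Tm.neg (Tm.succ t ≐ Tm.zero))
  | succ_inj {Γ : Ctx} {H : List (Tm Γ Ty.omega)} (s t : Tm Γ Ty.nat) :
      Derives H (Tm.succ s ≐ Tm.succ t ⇛ s ≐ t)
  | induction {Γ : Ctx} {H : List (Tm Γ Ty.omega)} (P : Tm Γ (Ty.nat ⇾ Ty.omega)) :
      Derives H (P ⬝ Tm.zero) →
      Derives H (Tm.all Ty.nat (P.wk ⬝ v0 ⇛ P.wk ⬝ Tm.succ v0)) →
      Derives H (Tm.all Ty.nat (P.wk ⬝ v0))
  | natrec_zero {Γ : Ctx} {H : List (Tm Γ Ty.omega)} {A : Ty} (a : Tm Γ A)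
      (f : Tm Γ (Ty.nat ⇾ A ⇾ A)) : Derives H (Tm.natrec a f Tm.zero ≐ a)
  | natrec_succ {Γ : Ctx} {H : List (Tm Γ Ty.omega)} {A : Ty} (a : Tm Γ A)
      (f : Tm Γ (Ty.nat ⇾ A ⇾ A)) (n : Tm Γ Ty.nat) :
      Derives H (Tm.natrec a f (Tm.succ n) ≐ f ⬝ n ⬝ Tm.natrec a f n)

/-- Sentences are formulas without free variables. -/
abbrev Sentence : Type := Tm [] Ty.omega

/-- A sentence is provable in a theory if it is derivable from finitely many of its members. -/
def Provable (T : Set Sentence) (p : Sentence) : Prop :=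
  ∃ H : List Sentence, (∀ h ∈ H, h ∈ T) ∧ Derives H p

/-! ### Semidecidability -/

/-- The formula `∀ n, f n = 0 ∨ f n = 1`: the map `f` is a binary sequence. -/
def isBinary {Γ : Ctx} (f : Tm Γ (Ty.nat ⇾ Ty.nat)) : Tm Γ Ty.omega :=
  Tm.all Ty.nat (f.wk ⬝ v0 ≐ Tm.zero ⋎ f.wk ⬝ v0 ≐ Tm.one)

/-- The formula `p ∈ Σ`: there is a binary sequence `f` with `p ↔ ∃ n, f n = 1`
(the Rosolini dominance). -/
def isSemidec {Γ : Ctx} (p : Tm Γ Ty.omega) : Tm Γ Ty.omega :=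
  Tm.ex (Ty.nat ⇾ Ty.nat) (isBinary v0 ⋏
    Tm.iff p.wk (Tm.ex Ty.nat (v1 ⬝ v0 ≐ Tm.one)))

/-- The formula `S ∈ Σ^X`, where the set `X` is given as a subset of the type `A`:
all truth values `S x` for `x ∈ X` are semidecidable. (Only the restriction of `S` to `X`
matters; every map from `X` to the truth values is such a restriction.) -/
def isSemidecOn {Γ : Ctx} {A : Ty} (X S : Tm Γ (A ⇾ Ty.omega)) : Tm Γ Ty.omega :=
  Tm.all A (X.wk ⬝ v0 ⇛ isSemidec (S.wk ⬝ v0))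

/-- The formula `S ∈ Σ^A`, for a type `A`: all truth values `S x` are semidecidable. -/
def isSemidecSet {Γ : Ctx} {A : Ty} (S : Tm Γ (A ⇾ Ty.omega)) : Tm Γ Ty.omega :=
  Tm.all A (isSemidec (S.wk ⬝ v0))

/-! ### The theory -/

/-- Dependent Choice for subsets `X` of the type `A`: if every `x ∈ X` is `R`-related to some
`y ∈ X`, then every `x ∈ X` is the start of a sequence in `X` of successively related elements. -/
def dependentChoice (A : Ty) : Sentence :=
  Tm.all (A ⇾ Ty.omega) (Tm.all (A ⇾ A ⇾ Ty.omega)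
    (Tm.all A (v2 ⬝ v0 ⇛ Tm.ex A (v3 ⬝ v0 ⋏ v2 ⬝ v1 ⬝ v0)) ⇛
      Tm.all A (v2 ⬝ v0 ⇛
        Tm.ex (Ty.nat ⇾ A) (v0 ⬝ Tm.zero ≐ v1 ⋏
          Tm.all Ty.nat (v4 ⬝ (v1 ⬝ v0) ⋏ v3 ⬝ (v1 ⬝ v0) ⬝ (v1 ⬝ Tm.succ v0))))))

/-- Markov principle: if not all terms of a binary sequence are zero, then the sequence
contains a one. -/
def markovPrinciple : Sentence :=
  Tm.all (Ty.nat ⇾ Ty.nat) (isBinary v0 ⇛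
    Tm.neg (Tm.all Ty.nat (v1 ⬝ v0 ≐ Tm.zero)) ⇛ Tm.ex Ty.nat (v1 ⬝ v0 ≐ Tm.one))

/-- Enumerability: there is a surjection `W` from the natural numbers onto the semidecidable
(that is, countable) subsets of the natural numbers. -/
def enumerability : Sentence :=
  Tm.ex (Ty.nat ⇾ Ty.nat ⇾ Ty.omega)
    (Tm.all Ty.nat (isSemidecSet (v1 ⬝ v0)) ⋏
      Tm.all (Ty.nat ⇾ Ty.omega) (isSemidecSet v0 ⇛ Tm.ex Ty.nat (v2 ⬝ v0 ≐ v1)))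

/-- Stable subspaces: if `X` is a `¬¬`-stable subset of the natural numbers, then every
semidecidable subset `S` of `X` is the restriction of a semidecidable `T` on all natural
numbers. -/
def stableSubspace : Sentence :=
  Tm.all (Ty.nat ⇾ Ty.omega)
    (Tm.all Ty.nat (Tm.neg (Tm.neg (v1 ⬝ v0)) ⇛ v1 ⬝ v0) ⇛
      Tm.all (Ty.nat ⇾ Ty.omega) (isSemidecOn v1 v0 ⇛
        Tm.ex (Ty.nat ⇾ Ty.omega) (isSemidecSet v0 ⋏
          Tm.all Ty.nat (v3 ⬝ v0 ⇛ Tm.iff (v1 ⬝ v0) (v2 ⬝ v0)))))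

/-- The theory of synthetic computability, over intuitionistic higher-order logic. -/
inductive SyntheticComputability : Set Sentence
  | dependentChoice (A : Ty) : SyntheticComputability (dependentChoice A)
  | markovPrinciple : SyntheticComputability markovPrinciple
  | enumerability : SyntheticComputability enumerability
  | stableSubspace : SyntheticComputability stableSubspace

/-! ### Intrinsic and weak intrinsic inclusions

The codomain `Y` is a subset of the type `B`; the domain is the type `A`. -/

/-- The formula stating that `i` maps `A` injectively into `Y`. -/
def isInjectionInto {Γ : Ctx} {A B : Ty} (Y : Tm Γ (B ⇾ Ty.omega)) (i : Tm Γ (A ⇾ B)) :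
    Tm Γ Ty.omega :=
  Tm.all A (Y.wk ⬝ (i.wk ⬝ v0)) ⋏
    Tm.all A (Tm.all A (i.wk.wk ⬝ v1 ≐ i.wk.wk ⬝ v0 ⇛ v1 ≐ v0))

/-- The formula stating that `i : A → Y` is an intrinsic inclusion: it is injective and for every
`S : A → Σ` there is `T : Y → Σ` with `T (i x) ↔ S x` for all `x`. -/
def isIntrinsicInclusion {Γ : Ctx} {A B : Ty} (Y : Tm Γ (B ⇾ Ty.omega)) (i : Tm Γ (A ⇾ B)) :
    Tm Γ Ty.omega :=
  isInjectionInto Y i ⋏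
    Tm.all (A ⇾ Ty.omega) (isSemidecSet v0 ⇛
      Tm.ex (B ⇾ Ty.omega) (isSemidecOn Y.wk.wk v0 ⋏
        Tm.all A (Tm.iff (v1 ⬝ (i.wk.wk.wk ⬝ v0)) (v2 ⬝ v0))))

/-- The formula stating that the relation `R` is a multivalued map from `Y` to `Σ`: to each
`y ∈ Y` it assigns an inhabited set of semidecidable truth values. -/
def isMultivaluedSemidec {Γ : Ctx} {B : Ty} (Y : Tm Γ (B ⇾ Ty.omega))
    (R : Tm Γ (B ⇾ Ty.omega ⇾ Ty.omega)) : Tm Γ Ty.omega :=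
  Tm.all B (Y.wk ⬝ v0 ⇛
    Tm.all Ty.omega (R.wk.wk ⬝ v1 ⬝ v0 ⇛ isSemidec v0) ⋏
    Tm.ex Ty.omega (R.wk.wk ⬝ v1 ⬝ v0))

/-- The formula stating that `i : A → Y` is a weak intrinsic inclusion: it is injective and for
every `S : A → Σ` there is a multivalued map `R` from `Y` to `Σ` whose set of values at each
`i x` is the singleton of `S x`. -/
def isWeakIntrinsicInclusion {Γ : Ctx} {A B : Ty} (Y : Tm Γ (B ⇾ Ty.omega))
    (i : Tm Γ (A ⇾ B)) : Tm Γ Ty.omega :=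
  isInjectionInto Y i ⋏
    Tm.all (A ⇾ Ty.omega) (isSemidecSet v0 ⇛
      Tm.ex (B ⇾ Ty.omega ⇾ Ty.omega) (isMultivaluedSemidec Y.wk.wk v0 ⋏
        Tm.all A (Tm.all Ty.omega
          (Tm.iff (v2 ⬝ (i.wk.wk.wk.wk ⬝ v1) ⬝ v0) (v0 ≐ v3 ⬝ v1)))))

/-! ### Baire space and graphs -/

/-- Baire space: the type of all sequences of natural numbers. -/
abbrev baire : Ty := Ty.nat ⇾ Ty.nat

/-- The type of all subsets of `ℕ × ℕ`. -/
abbrev powNN : Ty := Ty.prod Ty.nat Ty.nat ⇾ Ty.omega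

/-- The set of all semidecidable subsets of `ℕ × ℕ`. -/
def sigmaNN : Tm [] (powNN ⇾ Ty.omega) := Tm.lam powNN (isSemidecSet v0)

/-- The map that takes a sequence `a` to its graph, the set of all pairs `(n, a n)`. -/
def graphMap : Tm [] (baire ⇾ powNN) :=
  Tm.lam baire (Tm.lam (Ty.prod Ty.nat Ty.nat)
    (Tm.ex Ty.nat (v1 ≐ Tm.pair v0 (v2 ⬝ v0))))

end SynthComp

/-! Classical logic refutes the theory, so its consequences cannot be proved as Lean statements
about ordinary sets: a derivation must be shown to exist. This is done in a generic model. Its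
elements are terms in finitely many parameters modulo provable equality, its stages are truth values
ordered by entailment, and `c ⊩ p` means that `p` is derivable from `c`. The rules of the calculus
become Kripke–Joyal clauses, where disjunction and existence hold only locally (`Loc`). Taking the
conjunction of the hypotheses as the stage gives completeness (`derives_of_forces`), so the rest is
ordinary constructive mathematics relative to a stage that forces the axioms.

Weak intrinsic inclusion. Enumerability and countable choice list the semidecidable relations on ℕ
as U_0, U_1, … . The indices of graphs of sequences form a ¬¬-stable set: Markov's principle
recovers the values, and equality of numbers is stable (`Enumerates.index_stable`). A map S from
Baire space to Σ thus becomes a semidecidable subset of a stable set of numbers, which the Stable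
Subspace Axiom extends to some T on all of ℕ (`Enumerates.exists_extension`). The multivalued
extension sends U to the set of all T(k) with U_k = U. It is inhabited because U has an index, and
at the graph of a its only value is S(a).

Not an intrinsic inclusion. Friedberg's set F consists of the sequences a that are zero before some
k such that, if a is first nonzero at n, the k-th partial function agrees with a at n+1+k. It is
semidecidable: given an index k of a, either a is zero before k, and k is a witness, or the first
nonzero place is known, and membership is an existential statement with decidable matrix
(`Enumerates.semidec_friedberg`). The zero sequence lies in F, but every segment of it extends, up
to double negation, to a sequence outside F (`Axioms.exists_not_friedberg`). Suppose that T on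
Σ^(ℕ×ℕ) extends F. Such a T is upward closed on decidable relations, up to double negation
(`Axioms.upward_closed`). Let f semidecide p, and let U consist of the pairs (x, 0) such that f
vanishes up to and including x. If p fails, U is the graph of zero and T(U) holds. If p holds, U is
a finite segment contained in the graph of a sequence outside F, so T(U) fails. Hence ¬p is
semidecidable for every semidecidable p, which the diagonal argument excludes
(`Axioms.not_semidec_neg`). -/

namespace SynthComp

/-! ### Substitution calculus -/

section

variable {Γ Δ : Ctx} {A B C : Ty} (s : Ren Γ Δ) (x : Var Γ A) (b : Tm (C :: Γ) B)
  (f : Tm Γ (A ⇾ B)) (a b1 : Tm Γ A) (a2 : Tm Γ B) (q : Tm Γ (Ty.prod A B)) (n : Tm Γ Ty.nat)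
  (g : Tm Γ (Ty.nat ⇾ A ⇾ A)) (p q1 : Tm Γ Ty.omega) (o : Tm (C :: Γ) Ty.omega)

@[simp] theorem Tm.ren_var : (Tm.var x).ren s = Tm.var (s _ x) := rfl
@[simp] theorem Tm.ren_lam : (Tm.lam C b).ren s = Tm.lam C (b.ren (s.lift C)) := rfl
@[simp] theorem Tm.ren_app : (f ⬝ a).ren s = f.ren s ⬝ a.ren s := rfl
@[simp] theorem Tm.ren_pair : (Tm.pair a a2).ren s = Tm.pair (a.ren s) (a2.ren s) := rfl
@[simp] theorem Tm.ren_fst : (Tm.fst q).ren s = Tm.fst (q.ren s) := rfl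
@[simp] theorem Tm.ren_snd : (Tm.snd q).ren s = Tm.snd (q.ren s) := rfl
@[simp] theorem Tm.ren_zero : (Tm.zero : Tm Γ Ty.nat).ren s = Tm.zero := rfl
@[simp] theorem Tm.ren_succ : (Tm.succ n).ren s = Tm.succ (n.ren s) := rfl
@[simp] theorem Tm.ren_natrec : (Tm.natrec a g n).ren s = Tm.natrec (a.ren s) (g.ren s) (n.ren s) := rfl
@[simp] theorem Tm.ren_eq : (Tm.eq a b1).ren s = Tm.eq (a.ren s) (b1.ren s) := rfl
@[simp] theorem Tm.ren_fls : (Tm.fls : Tm Γ Ty.omega).ren s = Tm.fls := rfl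
@[simp] theorem Tm.ren_and : (Tm.and p q1).ren s = Tm.and (p.ren s) (q1.ren s) := rfl
@[simp] theorem Tm.ren_or : (Tm.or p q1).ren s = Tm.or (p.ren s) (q1.ren s) := rfl
@[simp] theorem Tm.ren_imp : (Tm.imp p q1).ren s = Tm.imp (p.ren s) (q1.ren s) := rfl
@[simp] theorem Tm.ren_all : (Tm.all C o).ren s = Tm.all C (o.ren (s.lift C)) := rfl
@[simp] theorem Tm.ren_ex : (Tm.ex C o).ren s = Tm.ex C (o.ren (s.lift C)) := rfl

end

section

variable {Γ Δ : Ctx} {A B C : Ty} (s : Sub Γ Δ) (x : Var Γ A) (b : Tm (C :: Γ) B)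
  (f : Tm Γ (A ⇾ B)) (a b1 : Tm Γ A) (a2 : Tm Γ B) (q : Tm Γ (Ty.prod A B)) (n : Tm Γ Ty.nat)
  (g : Tm Γ (Ty.nat ⇾ A ⇾ A)) (p q1 : Tm Γ Ty.omega) (o : Tm (C :: Γ) Ty.omega)

@[simp] theorem Tm.sub_var : (Tm.var x).sub s = s _ x := rfl
@[simp] theorem Tm.sub_lam : (Tm.lam C b).sub s = Tm.lam C (b.sub (s.lift C)) := rfl
@[simp] theorem Tm.sub_app : (f ⬝ a).sub s = f.sub s ⬝ a.sub s := rfl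
@[simp] theorem Tm.sub_pair : (Tm.pair a a2).sub s = Tm.pair (a.sub s) (a2.sub s) := rfl
@[simp] theorem Tm.sub_fst : (Tm.fst q).sub s = Tm.fst (q.sub s) := rfl
@[simp] theorem Tm.sub_snd : (Tm.snd q).sub s = Tm.snd (q.sub s) := rfl
@[simp] theorem Tm.sub_zero : (Tm.zero : Tm Γ Ty.nat).sub s = Tm.zero := rfl
@[simp] theorem Tm.sub_succ : (Tm.succ n).sub s = Tm.succ (n.sub s) := rfl
@[simp] theorem Tm.sub_natrec : (Tm.natrec a g n).sub s = Tm.natrec (a.sub s) (g.sub s) (n.sub s) := rfl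
@[simp] theorem Tm.sub_eq : (Tm.eq a b1).sub s = Tm.eq (a.sub s) (b1.sub s) := rfl
@[simp] theorem Tm.sub_fls : (Tm.fls : Tm Γ Ty.omega).sub s = Tm.fls := rfl
@[simp] theorem Tm.sub_and : (Tm.and p q1).sub s = Tm.and (p.sub s) (q1.sub s) := rfl
@[simp] theorem Tm.sub_or : (Tm.or p q1).sub s = Tm.or (p.sub s) (q1.sub s) := rfl
@[simp] theorem Tm.sub_imp : (Tm.imp p q1).sub s = Tm.imp (p.sub s) (q1.sub s) := rfl
@[simp] theorem Tm.sub_all : (Tm.all C o).sub s = Tm.all C (o.sub (s.lift C)) := rfl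
@[simp] theorem Tm.sub_ex : (Tm.ex C o).sub s = Tm.ex C (o.sub (s.lift C)) := rfl

end

section Substitution

variable {Γ Δ Θ : Ctx} {A B : Ty}

theorem Ren.lift_comp (r : Ren Γ Δ) (s : Ren Δ Θ) :
    (fun A x => s.lift B A (r.lift B A x)) = Ren.lift B (fun A x => s A (r A x)) := by
  funext A x; cases x <;> rfl

theorem Tm.ren_ren (t : Tm Γ A) {Δ Θ : Ctx} (r : Ren Γ Δ) (s : Ren Δ Θ) :
    (t.ren r).ren s = t.ren (fun A x => s A (r A x)) := by
  induction t generalizing Δ Θ <;> simp [*, Ren.lift_comp]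

theorem Sub.lift_ren (r : Ren Γ Δ) (s : Sub Δ Θ) :
    (fun A x => s.lift B A (r.lift B A x)) = Sub.lift B (fun A x => s A (r A x)) := by
  funext A x; cases x <;> rfl

theorem Tm.ren_sub (t : Tm Γ A) {Δ Θ : Ctx} (r : Ren Γ Δ) (s : Sub Δ Θ) :
    (t.ren r).sub s = t.sub (fun A x => s A (r A x)) := by
  induction t generalizing Δ Θ <;> simp [*, Sub.lift_ren]

theorem Tm.wk_ren_lift (t : Tm Γ A) (r : Ren Γ Δ) : t.wk.ren (r.lift B) = (t.ren r).wk := by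
  simp only [Tm.wk, Tm.ren_ren]; rfl

theorem Sub.ren_lift (s : Sub Γ Δ) (r : Ren Δ Θ) :
    (fun A x => (s.lift B A x).ren (r.lift B)) = Sub.lift B (fun A x => (s A x).ren r) := by
  funext A x
  cases x with
  | here => rfl
  | there x => exact Tm.wk_ren_lift _ _

theorem Tm.sub_ren (t : Tm Γ A) {Δ Θ : Ctx} (s : Sub Γ Δ) (r : Ren Δ Θ) :
    (t.sub s).ren r = t.sub (fun A x => (s A x).ren r) := by
  induction t generalizing Δ Θ <;> simp [*, Sub.ren_lift]

theorem Tm.wk_sub_lift (t : Tm Γ A) (s : Sub Γ Δ) : t.wk.sub (s.lift B) = (t.sub s).wk := by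
  simp only [Tm.wk, Tm.ren_sub, Tm.sub_ren]; rfl

theorem Sub.sub_lift (s : Sub Γ Δ) (s' : Sub Δ Θ) :
    (fun A x => (s.lift B A x).sub (s'.lift B)) = Sub.lift B (fun A x => (s A x).sub s') := by
  funext A x
  cases x with
  | here => rfl
  | there x => exact Tm.wk_sub_lift _ _

/-- Renamings have to be treated first: lifting a substitution under a binder weakens its values, so
each composition law needs the preceding ones for the binder case. -/
theorem Tm.sub_sub (t : Tm Γ A) {Δ Θ : Ctx} (s : Sub Γ Δ) (s' : Sub Δ Θ) :
    (t.sub s).sub s' = t.sub (fun A x => (s A x).sub s') := by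
  induction t generalizing Δ Θ <;> simp [*, Sub.sub_lift]

theorem Sub.lift_var : Sub.lift B (fun A (x : Var Γ A) => Tm.var x) = fun _ x => Tm.var x := by
  funext A x; cases x <;> rfl

theorem Tm.sub_id (t : Tm Γ A) : t.sub (fun _ x => Tm.var x) = t := by
  induction t <;> simp [*, Sub.lift_var]

theorem Sub.lift_var_comp (r : Ren Γ Δ) :
    Sub.lift B (fun A x => Tm.var (r A x)) = fun A x => Tm.var (r.lift B A x) := by
  funext A x; cases x <;> rfl

theorem Tm.ren_eq_sub (t : Tm Γ A) {Δ : Ctx} (r : Ren Γ Δ) :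
    t.ren r = t.sub (fun A x => Tm.var (r A x)) := by
  induction t generalizing Δ <;> simp [*, Sub.lift_var_comp]

theorem Tm.wk_inst (t : Tm Γ A) (u : Tm Γ B) : t.wk.inst u = t := by
  rw [Tm.wk, Tm.inst, Tm.ren_sub]; exact t.sub_id

/-- Extend a substitution by a term for the last variable. -/
def Sub.cons (u : Tm Δ A) (s : Sub Γ Δ) : Sub (A :: Γ) Δ
  | _, Var.here => u
  | _, Var.there x => s _ x

theorem Tm.sub_lift_inst (t : Tm (B :: Γ) A) (s : Sub Γ Δ) (u : Tm Δ B) :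
    (t.sub (s.lift B)).inst u = t.sub (Sub.cons u s) := by
  rw [Tm.inst, Tm.sub_sub]
  congr 1
  funext C x
  cases x with
  | here => rfl
  | there x => exact Tm.wk_inst _ _

theorem Tm.inst_sub (t : Tm (B :: Γ) A) (u : Tm Γ B) (s : Sub Γ Δ) :
    (t.inst u).sub s = (t.sub (s.lift B)).inst (u.sub s) := by
  rw [Tm.sub_lift_inst, Tm.inst, Tm.sub_sub]
  congr 1
  funext C x
  cases x <;> rfl

/-- Opening a binder with its own variable changes nothing. This lets `all_elim`, `ex_intro` and
`beta` be used at a fresh variable. -/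
theorem Tm.sub_lift_wk_inst (t : Tm (B :: Γ) A) :
    (t.ren (Ren.lift B (fun _ x => Var.there x))).inst v0 = t := by
  rw [Tm.inst, Tm.ren_sub]
  conv_rhs => rw [← t.sub_id]
  congr 1
  funext C x
  cases x <;> rfl

end Substitution

/-! ### Structural properties of derivations -/

theorem Derives.weaken {Γ : Ctx} {H : List (Tm Γ Ty.omega)} {p : Tm Γ Ty.omega}
    (h : Derives H p) : ∀ {H' : List (Tm Γ Ty.omega)}, H ⊆ H' → Derives H' p := by
  induction h with
  | hyp h => exact fun s => .hyp (s h)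
  | fls_elim _ ih => exact fun s => .fls_elim (ih s)
  | and_intro _ _ ih ih' => exact fun s => .and_intro (ih s) (ih' s)
  | and_left _ ih => exact fun s => .and_left (ih s)
  | and_right _ ih => exact fun s => .and_right (ih s)
  | or_inl _ ih => exact fun s => .or_inl (ih s)
  | or_inr _ ih => exact fun s => .or_inr (ih s)
  | or_elim _ _ _ ih i1 i2 =>
    exact fun s => .or_elim (ih s) (i1 (List.cons_subset_cons _ s)) (i2 (List.cons_subset_cons _ s))
  | imp_intro _ ih => exact fun s => .imp_intro (ih (List.cons_subset_cons _ s))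
  | imp_elim _ _ ih ih' => exact fun s => .imp_elim (ih s) (ih' s)
  | all_intro _ ih => exact fun s => .all_intro (ih (List.map_subset _ s))
  | all_elim t _ ih => exact fun s => .all_elim t (ih s)
  | ex_intro t _ ih => exact fun s => .ex_intro t (ih s)
  | ex_elim _ _ ih ih' =>
    exact fun s => .ex_elim (ih s) (ih' (List.cons_subset_cons _ (List.map_subset _ s)))
  | eq_refl t => exact fun _ => .eq_refl t
  | eq_subst p _ _ ih ih' => exact fun s => .eq_subst p (ih s) (ih' s)
  | prop_ext _ _ ih ih' => exact fun s => .prop_ext (ih s) (ih' s)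
  | fun_ext _ ih => exact fun s => .fun_ext (ih s)
  | beta b t => exact fun _ => .beta b t
  | fst_pair a b => exact fun _ => .fst_pair a b
  | snd_pair a b => exact fun _ => .snd_pair a b
  | pair_eta t => exact fun _ => .pair_eta t
  | unique_choice R _ ih => exact fun s => .unique_choice R (ih s)
  | succ_ne_zero t => exact fun _ => .succ_ne_zero t
  | succ_inj a b => exact fun _ => .succ_inj a b
  | induction P _ _ ih ih' => exact fun s => .induction P (ih s) (ih' s)
  | natrec_zero a f => exact fun _ => .natrec_zero a f
  | natrec_succ a f n => exact fun _ => .natrec_succ a f n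

theorem map_wk_map_sub_lift {Γ Δ : Ctx} {B : Ty} (H : List (Tm Γ Ty.omega)) (s : Sub Γ Δ) :
    (H.map (Tm.wk (B := B))).map (fun p => p.sub (s.lift B)) =
      (H.map fun p => p.sub s).map Tm.wk := by
  simp [Tm.wk_sub_lift]

/-- Needed to move derivations between contexts of parameters. Only the rules that mention `wk` or
`inst`, or that bind a variable, require the commutation laws. -/
theorem Derives.sub {Γ : Ctx} {H : List (Tm Γ Ty.omega)} {p : Tm Γ Ty.omega}
    (h : Derives H p) : ∀ {Δ : Ctx} (s : Sub Γ Δ), Derives (H.map fun p => p.sub s) (p.sub s) := by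
  induction h with
  | hyp h => exact fun s => .hyp (List.mem_map_of_mem h)
  | fls_elim _ ih => exact fun s => .fls_elim (ih s)
  | and_intro _ _ ih ih' => exact fun s => .and_intro (ih s) (ih' s)
  | and_left _ ih => exact fun s => .and_left (ih s)
  | and_right _ ih => exact fun s => .and_right (ih s)
  | or_inl _ ih => exact fun s => .or_inl (ih s)
  | or_inr _ ih => exact fun s => .or_inr (ih s)
  | or_elim _ _ _ ih i1 i2 => exact fun s => .or_elim (ih s) (i1 s) (i2 s)
  | imp_intro _ ih => exact fun s => .imp_intro (ih s)
  | imp_elim _ _ ih ih' => exact fun s => .imp_elim (ih s) (ih' s)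
  | all_intro _ ih =>
    intro _ s
    have h := ih (s.lift _)
    rw [map_wk_map_sub_lift] at h
    exact .all_intro h
  | all_elim t _ ih => intro _ s; rw [Tm.inst_sub]; exact .all_elim _ (ih s)
  | ex_intro t _ ih =>
    intro _ s
    have h := ih s
    rw [Tm.inst_sub] at h
    exact .ex_intro _ h
  | ex_elim _ _ ih ih' =>
    intro _ s
    have h := ih' (s.lift _)
    rw [List.map_cons, map_wk_map_sub_lift, Tm.wk_sub_lift] at h
    exact .ex_elim (ih s) h
  | eq_refl t => exact fun _ => .eq_refl _
  | eq_subst p _ _ ih ih' =>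
    intro _ s
    have h := ih' s
    rw [Tm.inst_sub] at h ⊢
    exact .eq_subst _ (ih s) h
  | prop_ext _ _ ih ih' => exact fun s => .prop_ext (ih s) (ih' s)
  | fun_ext _ ih =>
    intro _ s
    have h := ih s
    simp [Tm.wk_sub_lift] at h
    exact .fun_ext h
  | beta b t => intro _ s; simp [Tm.inst_sub]; exact .beta _ _
  | fst_pair a b => exact fun _ => .fst_pair _ _
  | snd_pair a b => exact fun _ => .snd_pair _ _
  | pair_eta t => exact fun _ => .pair_eta _
  | unique_choice R _ ih =>
    intro _ s
    have h := ih s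
    simp [Tm.wk_sub_lift] at h ⊢
    exact .unique_choice _ h
  | succ_ne_zero t => exact fun _ => .succ_ne_zero _
  | succ_inj a b => exact fun _ => .succ_inj _ _
  | induction P _ _ ih ih' =>
    intro _ s
    have h := ih' s
    simp [Tm.wk_sub_lift] at h ⊢
    exact .induction _ (ih s) h
  | natrec_zero a f => exact fun _ => .natrec_zero _ _
  | natrec_succ a f n => exact fun _ => .natrec_succ _ _ _

/-! ### Congruence: provable equality inside the calculus -/

section

variable {Γ : Ctx} {A B : Ty} (u : Tm Γ B)

theorem Tm.inst_v0 : (v0 : Tm (B :: Γ) B).inst u = u := rfl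

theorem Tm.inst_eq (s t : Tm (B :: Γ) A) : (s ≐ t).inst u = (s.inst u ≐ t.inst u) := rfl

theorem Tm.inst_natrec (a : Tm (B :: Γ) A) (f : Tm (B :: Γ) (Ty.nat ⇾ A ⇾ A))
    (n : Tm (B :: Γ) Ty.nat) :
    (Tm.natrec a f n).inst u = Tm.natrec (a.inst u) (f.inst u) (n.inst u) := rfl

end

section Congruence

variable {Γ : Ctx} {H : List (Tm Γ Ty.omega)} {A B C : Ty}

theorem Derives.wk {p : Tm Γ Ty.omega} (h : Derives H p) :
    Derives (H.map (Tm.wk (B := B))) p.wk := by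
  have := h.sub (fun A x => Tm.var (Var.there (B := B) x))
  simp only [← Tm.ren_eq_sub] at this
  exact this

theorem Derives.congr (q : Tm (A :: Γ) B) {s t : Tm Γ A} (h : Derives H (s ≐ t)) :
    Derives H (q.inst s ≐ q.inst t) := by
  have h' := Derives.eq_subst ((q.inst s).wk ≐ q) h
  simp only [Tm.inst_eq, Tm.wk_inst] at h'
  exact h' (.eq_refl _)

theorem Derives.eq_symm {s t : Tm Γ A} (h : Derives H (s ≐ t)) : Derives H (t ≐ s) := by
  have h' := Derives.eq_subst (v0 ≐ s.wk) h
  simp only [Tm.inst_eq, Tm.wk_inst, Tm.inst_v0] at h'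
  exact h' (.eq_refl _)

theorem Derives.eq_mp {p q : Tm Γ Ty.omega} (h : Derives H (p ≐ q)) (hp : Derives H p) :
    Derives H q :=
  Derives.eq_subst (s := p) (t := q) v0 h hp

theorem Derives.eq_trans {s t u : Tm Γ A} (h : Derives H (s ≐ t)) (h' : Derives H (t ≐ u)) :
    Derives H (s ≐ u) := by
  have h2 := Derives.congr (s.wk ≐ v0) h'
  simp only [Tm.inst_eq, Tm.wk_inst, Tm.inst_v0] at h2
  exact Derives.eq_mp h2 h

/-- Congruence for a binary operation on terms that commutes with substitution. -/
theorem Derives.congr₂ (op : ∀ {Γ : Ctx}, Tm Γ A → Tm Γ B → Tm Γ C)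
    (hop : ∀ {Γ Δ : Ctx} (s : Tm Γ A) (t : Tm Γ B) (σ : Sub Γ Δ),
      (op s t).sub σ = op (s.sub σ) (t.sub σ))
    {s s' : Tm Γ A} {t t' : Tm Γ B} (h : Derives H (s ≐ s')) (h' : Derives H (t ≐ t')) :
    Derives H (op s t ≐ op s' t') := by
  have h1 := Derives.congr (op v0 t.wk) h
  have h2 := Derives.congr (op s'.wk v0) h'
  have hi : ∀ {D : Ty} (s : Tm (D :: Γ) A) (t : Tm (D :: Γ) B) u,
      (op s t).inst u = op (s.inst u) (t.inst u) := fun _ _ _ => hop _ _ _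
  simp only [hi, Tm.wk_inst, Tm.inst_v0] at h1 h2
  exact h1.eq_trans h2

/-- Congruence for a unary operation on terms that commutes with substitution. -/
theorem Derives.congr₁ (op : ∀ {Γ : Ctx}, Tm Γ A → Tm Γ B)
    (hop : ∀ {Γ Δ : Ctx} (s : Tm Γ A) (σ : Sub Γ Δ), (op s).sub σ = op (s.sub σ))
    {s s' : Tm Γ A} (h : Derives H (s ≐ s')) : Derives H (op s ≐ op s') := by
  have h1 := Derives.congr (op v0) h
  simp only [Tm.inst, hop] at h1
  exact h1

/-- The calculus has no rule for equality under λ. It follows from function extensionality once both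
sides are applied to a fresh variable and β-reduced. -/
theorem Derives.lam_congr {b b' : Tm (A :: Γ) B} (h : Derives (H.map Tm.wk) (b ≐ b')) :
    Derives H (Tm.lam A b ≐ Tm.lam A b') := by
  have hb : ∀ b : Tm (A :: Γ) B, Derives (H.map Tm.wk) ((Tm.lam A b).wk ⬝ v0 ≐ b) := by
    intro b
    have := Derives.beta (H := H.map Tm.wk) (b.ren (Ren.lift A (fun _ x => Var.there x))) v0
    rwa [Tm.sub_lift_wk_inst] at this
  exact .fun_ext (.all_intro (((hb b).eq_trans h).eq_trans (hb b').eq_symm))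

theorem Derives.inst_v0_wk {p : Tm (A :: Γ) Ty.omega} (h : Derives H (Tm.all A p)) :
    Derives (H.map Tm.wk) p := by
  have h' := Derives.all_elim v0 (h.wk (B := A))
  rwa [Tm.sub_lift_wk_inst] at h'

theorem Derives.all_congr {p q : Tm (A :: Γ) Ty.omega} (h : Derives (H.map Tm.wk) (p ≐ q)) :
    Derives H (Tm.all A p ≐ Tm.all A q) := by
  have key : ∀ p q : Tm (A :: Γ) Ty.omega, Derives (H.map Tm.wk) (p ≐ q) →
      Derives H (Tm.all A p ⇛ Tm.all A q) := by
    intro p q h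
    refine .imp_intro (.all_intro (Derives.eq_mp (h.weaken ?_) ?_))
    · simp
    · exact Derives.inst_v0_wk (.hyp (by simp))
  exact .prop_ext (key p q h) (key q p h.eq_symm)

theorem Derives.ex_congr {p q : Tm (A :: Γ) Ty.omega} (h : Derives (H.map Tm.wk) (p ≐ q)) :
    Derives H (Tm.ex A p ≐ Tm.ex A q) := by
  have key : ∀ p q : Tm (A :: Γ) Ty.omega, Derives (H.map Tm.wk) (p ≐ q) →
      Derives H (Tm.ex A p ⇛ Tm.ex A q) := by
    intro p q h
    refine .imp_intro (.ex_elim (.hyp (List.mem_cons_self ..)) (Derives.ex_intro v0 ?_))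
    rw [Tm.sub_lift_wk_inst]
    refine Derives.eq_mp (h.weaken ?_) (.hyp (by simp))
    intro x hx
    simp only [List.map_cons, List.mem_cons]
    exact .inr (.inr hx)
  exact .prop_ext (key p q h) (key q p h.eq_symm)

/-- Provably equal substitutions give provably equal terms. -/
theorem Derives.sub_congr (t : Tm Γ A) : ∀ {Δ : Ctx} {s s' : Sub Γ Δ},
    (∀ A x, Derives [] (s A x ≐ s' A x)) → Derives [] (t.sub s ≐ t.sub s') := by
  have hl : ∀ {Γ Δ : Ctx} {s s' : Sub Γ Δ} (B : Ty),
      (∀ A x, Derives [] (s A x ≐ s' A x)) →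
      ∀ A x, Derives [] (s.lift B A x ≐ s'.lift B A x) := by
    intro Γ Δ s s' B h A x
    cases x with
    | here => exact .eq_refl _
    | there x => exact (h _ x).wk (B := B)
  induction t with
  | var x => exact fun h => h _ x
  | lam B b ih => exact fun h => .lam_congr (ih (hl B h))
  | app f a ih ih' => exact fun h => .congr₂ (fun s t => s ⬝ t) (fun _ _ _ => rfl) (ih h) (ih' h)
  | pair a b ih ih' => exact fun h => .congr₂ Tm.pair (fun _ _ _ => rfl) (ih h) (ih' h)
  | fst a ih => exact fun h => .congr₁ Tm.fst (fun _ _ => rfl) (ih h)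
  | snd a ih => exact fun h => .congr₁ Tm.snd (fun _ _ => rfl) (ih h)
  | zero => exact fun _ => .eq_refl _
  | succ a ih => exact fun h => .congr₁ Tm.succ (fun _ _ => rfl) (ih h)
  | natrec a f n iha ihf ihn =>
    intro Δ s s' h
    have h1 := Derives.congr (Tm.natrec v0 (f.sub s).wk (n.sub s).wk) (iha h)
    have h2 := Derives.congr (Tm.natrec (a.sub s').wk v0 (n.sub s).wk) (ihf h)
    have h3 := Derives.congr (Tm.natrec (a.sub s').wk (f.sub s').wk v0) (ihn h)
    simp only [Tm.inst_natrec, Tm.wk_inst, Tm.inst_v0] at h1 h2 h3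
    exact (h1.eq_trans h2).eq_trans h3
  | eq a b ih ih' => exact fun h => .congr₂ Tm.eq (fun _ _ _ => rfl) (ih h) (ih' h)
  | fls => exact fun _ => .eq_refl _
  | and a b ih ih' => exact fun h => .congr₂ Tm.and (fun _ _ _ => rfl) (ih h) (ih' h)
  | or a b ih ih' => exact fun h => .congr₂ Tm.or (fun _ _ _ => rfl) (ih h) (ih' h)
  | imp a b ih ih' => exact fun h => .congr₂ Tm.imp (fun _ _ _ => rfl) (ih h) (ih' h)
  | all B p ih => exact fun h => .all_congr (ih (hl B h))
  | ex B p ih => exact fun h => .ex_congr (ih (hl B h))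

end Congruence

/-! ### Contexts of parameters -/

/-- An injective numbering of the types. -/
def Ty.code : Ty → ℕ
  | Ty.nat => 0
  | Ty.omega => 1
  | Ty.prod A B => 2 * Nat.pair A.code B.code + 2
  | Ty.arr A B => 2 * Nat.pair A.code B.code + 3

theorem Ty.code_injective : Function.Injective Ty.code := by
  intro A
  induction A with
  | nat => intro B h; cases B <;> simp [Ty.code] at h ⊢
  | omega => intro B h; cases B <;> simp [Ty.code] at h ⊢
  | prod A A' ih ih' =>
    intro B h
    cases B with
    | prod B B' =>
      have h' : Nat.pair A.code A'.code = Nat.pair B.code B'.code := by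
        simp only [Ty.code] at h; omega
      rw [Nat.pair_eq_pair] at h'
      rw [ih h'.1, ih' h'.2]
    | _ => simp only [Ty.code] at h; omega
  | arr A A' ih ih' =>
    intro B h
    cases B with
    | arr B B' =>
      have h' : Nat.pair A.code A'.code = Nat.pair B.code B'.code := by
        simp only [Ty.code] at h; omega
      rw [Nat.pair_eq_pair] at h'
      rw [ih h'.1, ih' h'.2]
    | _ => simp only [Ty.code] at h; omega

instance : Nonempty Ty := ⟨Ty.nat⟩

/-- The type of the `n`-th parameter; every type occurs infinitely often. -/
noncomputable def paramTy (n : ℕ) : Ty := Function.invFun Ty.code n.unpair.2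

theorem exists_paramTy (A : Ty) (n : ℕ) : ∃ m, n ≤ m ∧ paramTy m = A :=
  ⟨Nat.pair n A.code, Nat.left_le_pair _ _, by
    rw [paramTy, Nat.unpair_pair]; exact Function.leftInverse_invFun Ty.code_injective A⟩

/-- The context of the first `n` parameters. -/
noncomputable def level : ℕ → Ctx
  | 0 => []
  | n + 1 => paramTy n :: level n

/-- Extend the codomain of a renaming by one parameter. -/
noncomputable def Ren.there {n k : ℕ} (r : Ren (level n) (level k)) : Ren (level n) (level (k + 1)) :=
  fun A x => Var.there (r A x)

/-- The inclusion of the first `n` parameters into the first `m`. -/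
noncomputable def up {n m : ℕ} (h : n ≤ m) : Ren (level n) (level m) :=
  Nat.leRec (motive := fun m _ => Ren (level n) (level m)) (fun _ x => x)
    (fun _ _ r => r.there) h

theorem up_self (n : ℕ) : up (le_refl n) = fun _ x => x := by
  rw [up, Nat.leRec_self]

theorem up_succ {n m : ℕ} (h : n ≤ m) :
    up (Nat.le_succ_of_le h) = (up h).there := by
  rw [up, up, Nat.leRec_succ]

theorem up_up {n m k : ℕ} (h : n ≤ m) (h' : m ≤ k) (A : Ty) (x : Var (level n) A) :
    up h' A (up h A x) = up (h.trans h') A x := by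
  induction h' with
  | refl => rw [up_self]
  | step h' ih =>
    have e := congrFun (congrFun (up_succ h') A) (up h A x)
    have e' := congrFun (congrFun (up_succ (h.trans h')) A) x
    exact e.trans ((congrArg Var.there ih).trans e'.symm)

/-- A closed term of each type. -/
def Tm.default {Γ : Ctx} : (A : Ty) → Tm Γ A
  | Ty.nat => Tm.zero
  | Ty.omega => Tm.fls
  | Ty.prod A B => Tm.pair (Tm.default A) (Tm.default B)
  | Ty.arr A B => Tm.lam A (Tm.default B)

/-- The additional parameters are replaced by closed terms, which exist at every type. -/
theorem exists_down {n m : ℕ} (h : n ≤ m) :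
    ∃ s : Sub (level m) (level n), ∀ A x, s A (up h A x) = Tm.var x := by
  induction h with
  | refl => exact ⟨fun _ x => Tm.var x, fun A x => by rw [up_self]⟩
  | step h ih =>
    obtain ⟨s, hs⟩ := ih
    refine ⟨Sub.cons (Tm.default _) s, fun A x => ?_⟩
    have e := congrFun (congrFun (up_succ h) A) x
    exact (congrArg (Sub.cons (Tm.default _) s A) e).trans (hs A x)

/-- Regard a term in the first `n` parameters as a term in the first `m`. -/
noncomputable def Tm.up {n m : ℕ} {A : Ty} (h : n ≤ m) (t : Tm (level n) A) : Tm (level m) A :=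
  t.ren (SynthComp.up h)

theorem Tm.up_up {n m k : ℕ} {A : Ty} (h : n ≤ m) (h' : m ≤ k) (t : Tm (level n) A) :
    (t.up h).up h' = t.up (h.trans h') := by
  simp only [Tm.up, Tm.ren_ren, SynthComp.up_up]

theorem Tm.up_eq {n m : ℕ} {A : Ty} (h : n ≤ m) (s t : Tm (level n) A) :
    (s ≐ t).up h = (s.up h ≐ t.up h) := rfl

theorem Tm.up_succ {n : ℕ} {A : Ty} (t : Tm (level n) A) :
    t.up (Nat.le_succ n) = t.wk (B := paramTy n) := by
  have e : SynthComp.up (Nat.le_succ n) = fun _ x => Var.there x := by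
    have e := SynthComp.up_succ (le_refl n)
    rw [up_self] at e
    exact e
  rw [Tm.up, Tm.wk, e]
  rfl

theorem Derives.up {n m : ℕ} (h : n ≤ m) {H : List (Tm (level n) Ty.omega)}
    {p : Tm (level n) Ty.omega} (d : Derives H p) : Derives (H.map (Tm.up h)) (p.up h) := by
  have := d.sub (fun A x => Tm.var (SynthComp.up h A x))
  simp only [← Tm.ren_eq_sub] at this
  exact this

/-- Parameters that do not occur in a sequent can be discarded. Hence entailment and provable
equality do not depend on the level at which they are tested. -/
theorem Derives.of_up {n m : ℕ} (h : n ≤ m) {H : List (Tm (level n) Ty.omega)}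
    {p : Tm (level n) Ty.omega} (d : Derives (H.map (Tm.up h)) (p.up h)) : Derives H p := by
  obtain ⟨s, hs⟩ := exists_down h
  have hs' : ∀ p : Tm (level n) Ty.omega, (p.up h).sub s = p := by
    intro p
    rw [Tm.up, Tm.ren_sub]
    simp only [hs]
    exact p.sub_id
  have := d.sub s
  rw [hs', List.map_map] at this
  convert this
  symm
  simp [Function.comp_def, hs']

/-! ### The generic model -/

/-- Terms in finitely many parameters, up to provable equality. -/
def modelSetoid (A : Ty) : Setoid (Σ n, Tm (level n) A) where
  r a b := ∃ (k : ℕ) (h : a.1 ≤ k) (h' : b.1 ≤ k), Derives [] (a.2.up h ≐ b.2.up h')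
  iseqv := by
    refine ⟨fun a => ⟨a.1, le_refl _, le_refl _, .eq_refl _⟩, ?_, ?_⟩
    · rintro a b ⟨k, h, h', d⟩
      exact ⟨k, h', h, d.eq_symm⟩
    · rintro a b c ⟨k, h, h', d⟩ ⟨l, g, g', e⟩
      refine ⟨max k l, h.trans (le_max_left _ _), g'.trans (le_max_right _ _), ?_⟩
      have d' := d.up (le_max_left k l)
      have e' := e.up (le_max_right k l)
      simp only [Tm.up_eq, Tm.up_up, List.map_nil] at d' e'
      exact d'.eq_trans e'

/-- The elements of type `A` of the generic model. -/
def M (A : Ty) : Type := Quotient (modelSetoid A)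

/-- The element denoted by a term in `n` parameters. -/
def M.mk {A : Ty} (n : ℕ) (t : Tm (level n) A) : M A := Quotient.mk (modelSetoid A) ⟨n, t⟩

theorem M.mk_up {A : Ty} {n m : ℕ} (h : n ≤ m) (t : Tm (level n) A) :
    M.mk m (t.up h) = M.mk n t := by
  refine Quotient.sound ⟨m, le_refl _, h, ?_⟩
  simp only [Tm.up_up]
  exact .eq_refl _

theorem M.mk_eq_iff {A : Ty} {n : ℕ} {s t : Tm (level n) A} :
    M.mk n s = M.mk n t ↔ Derives [] (s ≐ t) := by
  constructor
  · intro h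
    obtain ⟨k, h, _, d⟩ := Quotient.exact h
    exact Derives.of_up h d
  · exact fun d => Quotient.sound ⟨n, le_refl _, le_refl _, d.up (le_refl n)⟩

/-- All sufficiently large levels are offered, so that several elements can be presented at a common
one. -/
theorem M.exists_mk {A : Ty} (x : M A) : ∃ n, ∀ m, n ≤ m → ∃ t, M.mk m t = x := by
  induction x using Quotient.inductionOn with
  | h a => exact ⟨a.1, fun m h => ⟨a.2.up h, M.mk_up h a.2⟩⟩

/-- An assignment of elements of the model to the variables of a context. -/
abbrev Env (Γ : Ctx) : Type := ∀ A : Ty, Var Γ A → M A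

/-- The empty environment. -/
def Env.nil : Env [] := fun _ x => nomatch x

/-- Extend an environment by a value for the last variable. -/
def Env.cons {Γ : Ctx} {A : Ty} (a : M A) (ρ : Env Γ) : Env (A :: Γ)
  | _, Var.here => a
  | _, Var.there x => ρ _ x

infixr:67 " ∷ " => Env.cons

/-- The substitution `s` represents the environment `ρ`. -/
def Represents {Γ : Ctx} (n : ℕ) (s : Sub Γ (level n)) (ρ : Env Γ) : Prop :=
  ∀ A x, M.mk n (s A x) = ρ A x

section

variable {Γ Δ : Ctx} {A B : Ty}

theorem Represents.up {n m : ℕ} (h : n ≤ m) {s : Sub Γ (level n)} {ρ : Env Γ}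
    (hs : Represents n s ρ) : Represents m (fun A x => (s A x).up h) ρ :=
  fun A x => (M.mk_up h _).trans (hs A x)

theorem Represents.cons {n : ℕ} {s : Sub Γ (level n)} {ρ : Env Γ} (hs : Represents n s ρ)
    {t : Tm (level n) A} {a : M A} (ht : M.mk n t = a) : Represents n (Sub.cons t s) (a ∷ ρ)
  | _, Var.here => ht
  | _, Var.there x => hs _ x

theorem exists_represents : ∀ {Γ : Ctx} (ρ : Env Γ),
    ∃ n, ∀ m, n ≤ m → ∃ s, Represents m s ρ
  | [], ρ => ⟨0, fun m _ => ⟨fun _ x => (nomatch x), fun _ x => (nomatch x)⟩⟩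
  | A :: Γ, ρ => by
    obtain ⟨n, hn⟩ := exists_represents (fun B x => ρ B (Var.there x))
    obtain ⟨k, hk⟩ := (ρ A Var.here).exists_mk
    refine ⟨max n k, fun m h => ?_⟩
    obtain ⟨s, hs⟩ := hn m ((le_max_left _ _).trans h)
    obtain ⟨t, ht⟩ := hk m ((le_max_right _ _).trans h)
    refine ⟨Sub.cons t s, fun B x => ?_⟩
    cases x with
    | here => exact ht
    | there x => exact hs _ x

theorem exists_represents_at (ρ : Env Γ) : ∃ n, ∃ s, Represents n s ρ :=
  let ⟨n, h⟩ := exists_represents ρ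
  ⟨n, h n le_rfl⟩

/-- The value of a term in the generic model. -/
noncomputable def interp (t : Tm Γ A) (ρ : Env Γ) : M A :=
  M.mk (exists_represents_at ρ).choose (t.sub (exists_represents_at ρ).choose_spec.choose)

notation "⟪" t "⟫" => interp t

/-- Independence of the chosen representatives: any two agree up to provable equality at a common
level, and substitution respects provable equality. -/
theorem interp_eq_mk {n : ℕ} {s : Sub Γ (level n)} {ρ : Env Γ} (hs : Represents n s ρ)
    (t : Tm Γ A) : ⟪t⟫ ρ = M.mk n (t.sub s) := by
  have key : ∀ {n m : ℕ} {s : Sub Γ (level n)} {s' : Sub Γ (level m)},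
      Represents n s ρ → Represents m s' ρ → M.mk n (t.sub s) = M.mk m (t.sub s') := by
    intro n m s s' hs hs'
    have h := hs.up (le_max_left n m)
    have h' := hs'.up (le_max_right n m)
    rw [← M.mk_up (le_max_left n m), ← M.mk_up (le_max_right n m), M.mk_eq_iff, Tm.up, Tm.up,
      Tm.sub_ren, Tm.sub_ren]
    exact Derives.sub_congr t fun A x => M.mk_eq_iff.1 ((h A x).trans (h' A x).symm)
  exact key (exists_represents_at ρ).choose_spec.choose_spec hs

theorem interp_sub (t : Tm Γ A) (s : Sub Γ Δ) (ρ : Env Δ) :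
    ⟪t.sub s⟫ ρ = ⟪t⟫ (fun B x => ⟪s B x⟫ ρ) := by
  obtain ⟨n, σ, hσ⟩ := exists_represents_at ρ
  rw [interp_eq_mk hσ, interp_eq_mk (s := fun B x => (s B x).sub σ), Tm.sub_sub]
  exact fun B x => (interp_eq_mk hσ _).symm

@[simp] theorem interp_var (x : Var Γ A) (ρ : Env Γ) : ⟪Tm.var x⟫ ρ = ρ A x := by
  obtain ⟨n, σ, hσ⟩ := exists_represents_at ρ
  rw [interp_eq_mk hσ]; exact hσ A x

@[simp] theorem Env.cons_here (a : M A) (ρ : Env Γ) : (a ∷ ρ) A Var.here = a := rfl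

@[simp] theorem Env.cons_there (a : M A) (ρ : Env Γ) (x : Var Γ B) :
    (a ∷ ρ) B (Var.there x) = ρ B x := rfl

@[simp] theorem interp_wk (t : Tm Γ A) (a : M B) (ρ : Env Γ) : ⟪t.wk⟫ (a ∷ ρ) = ⟪t⟫ ρ := by
  rw [Tm.wk, Tm.ren_eq_sub, interp_sub]; simp

theorem interp_sub_cons (t : Tm (B :: Γ) A) (u : Tm Δ B) (s : Sub Γ Δ) (ρ : Env Δ) :
    ⟪t.sub (Sub.cons u s)⟫ ρ = ⟪t⟫ (⟪u⟫ ρ ∷ fun C x => ⟪s C x⟫ ρ) := by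
  rw [interp_sub]
  congr 1
  funext C x
  cases x <;> rfl

/-! ### Operations of the model -/

/-- Application. -/
noncomputable def M.app (f : M (A ⇾ B)) (a : M A) : M B :=
  ⟪(v1 ⬝ v0 : Tm [A, A ⇾ B] B)⟫ (a ∷ f ∷ Env.nil)

infixl:90 " ◃ " => M.app

/-- Pairing. -/
noncomputable def M.pair (a : M A) (b : M B) : M (Ty.prod A B) :=
  ⟪(Tm.pair v1 v0 : Tm [B, A] _)⟫ (b ∷ a ∷ Env.nil)

/-- First projection. -/
noncomputable def M.fst (a : M (Ty.prod A B)) : M A := ⟪(Tm.fst v0 : Tm [_] _)⟫ (a ∷ Env.nil)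

/-- Second projection. -/
noncomputable def M.snd (a : M (Ty.prod A B)) : M B := ⟪(Tm.snd v0 : Tm [_] _)⟫ (a ∷ Env.nil)

/-- Zero. -/
noncomputable def M.zero : M Ty.nat := ⟪(Tm.zero : Tm [] _)⟫ Env.nil

/-- Successor. -/
noncomputable def M.succ (a : M Ty.nat) : M Ty.nat := ⟪(Tm.succ v0 : Tm [_] _)⟫ (a ∷ Env.nil)

/-- Primitive recursion. -/
noncomputable def M.natrec (a : M A) (f : M (Ty.nat ⇾ A ⇾ A)) (n : M Ty.nat) : M A :=
  ⟪(Tm.natrec v2 v1 v0 : Tm [Ty.nat, _, A] A)⟫ (n ∷ f ∷ a ∷ Env.nil)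

/-- The truth value of an equality. -/
noncomputable def M.eq (a b : M A) : M Ty.omega := ⟪(v1 ≐ v0 : Tm [A, A] _)⟫ (b ∷ a ∷ Env.nil)

/-- Falsity. -/
noncomputable def M.fls : M Ty.omega := ⟪(Tm.fls : Tm [] _)⟫ Env.nil

theorem represents_nil {n : ℕ} : Represents (Γ := []) n (fun _ x => nomatch x) Env.nil :=
  fun _ x => nomatch x

theorem M.mk_app {n : ℕ} (f : Tm (level n) (A ⇾ B)) (a : Tm (level n) A) :
    M.mk n f ◃ M.mk n a = M.mk n (f ⬝ a) :=
  interp_eq_mk ((represents_nil.cons rfl).cons rfl) _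

theorem M.mk_pair {n : ℕ} (a : Tm (level n) A) (b : Tm (level n) B) :
    M.pair (M.mk n a) (M.mk n b) = M.mk n (Tm.pair a b) :=
  interp_eq_mk ((represents_nil.cons rfl).cons rfl) _

theorem M.mk_fst {n : ℕ} (a : Tm (level n) (Ty.prod A B)) :
    M.fst (M.mk n a) = M.mk n (Tm.fst a) := interp_eq_mk (represents_nil.cons rfl) _

theorem M.mk_snd {n : ℕ} (a : Tm (level n) (Ty.prod A B)) :
    M.snd (M.mk n a) = M.mk n (Tm.snd a) := interp_eq_mk (represents_nil.cons rfl) _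

theorem M.mk_zero (n : ℕ) : M.zero = M.mk n Tm.zero := interp_eq_mk represents_nil _

theorem M.mk_succ {n : ℕ} (a : Tm (level n) Ty.nat) : M.succ (M.mk n a) = M.mk n (Tm.succ a) :=
  interp_eq_mk (represents_nil.cons rfl) _

theorem M.mk_natrec {n : ℕ} (a : Tm (level n) A) (f : Tm (level n) (Ty.nat ⇾ A ⇾ A))
    (k : Tm (level n) Ty.nat) :
    M.natrec (M.mk n a) (M.mk n f) (M.mk n k) = M.mk n (Tm.natrec a f k) :=
  interp_eq_mk (((represents_nil.cons rfl).cons rfl).cons rfl) _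

theorem M.mk_eq {n : ℕ} (a b : Tm (level n) A) :
    M.eq (M.mk n a) (M.mk n b) = M.mk n (a ≐ b) :=
  interp_eq_mk ((represents_nil.cons rfl).cons rfl) _

theorem M.mk_fls (n : ℕ) : M.fls = M.mk n Tm.fls := interp_eq_mk represents_nil _

variable (ρ : Env Γ)

@[simp] theorem interp_app (f : Tm Γ (A ⇾ B)) (a : Tm Γ A) : ⟪f ⬝ a⟫ ρ = ⟪f⟫ ρ ◃ ⟪a⟫ ρ := by
  obtain ⟨n, σ, hσ⟩ := exists_represents_at ρ
  simp only [interp_eq_mk hσ, M.mk_app, Tm.sub_app]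

@[simp] theorem interp_pair (a : Tm Γ A) (b : Tm Γ B) :
    ⟪Tm.pair a b⟫ ρ = M.pair (⟪a⟫ ρ) (⟪b⟫ ρ) := by
  obtain ⟨n, σ, hσ⟩ := exists_represents_at ρ
  simp only [interp_eq_mk hσ, M.mk_pair, Tm.sub_pair]

@[simp] theorem interp_fst (a : Tm Γ (Ty.prod A B)) : ⟪Tm.fst a⟫ ρ = M.fst (⟪a⟫ ρ) := by
  obtain ⟨n, σ, hσ⟩ := exists_represents_at ρ
  simp only [interp_eq_mk hσ, M.mk_fst, Tm.sub_fst]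

@[simp] theorem interp_snd (a : Tm Γ (Ty.prod A B)) : ⟪Tm.snd a⟫ ρ = M.snd (⟪a⟫ ρ) := by
  obtain ⟨n, σ, hσ⟩ := exists_represents_at ρ
  simp only [interp_eq_mk hσ, M.mk_snd, Tm.sub_snd]

@[simp] theorem interp_zero : ⟪Tm.zero⟫ ρ = M.zero := by
  obtain ⟨n, σ, hσ⟩ := exists_represents_at ρ
  simp only [interp_eq_mk hσ, M.mk_zero n, Tm.sub_zero]

@[simp] theorem interp_succ (a : Tm Γ Ty.nat) : ⟪Tm.succ a⟫ ρ = M.succ (⟪a⟫ ρ) := by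
  obtain ⟨n, σ, hσ⟩ := exists_represents_at ρ
  simp only [interp_eq_mk hσ, M.mk_succ, Tm.sub_succ]

@[simp] theorem interp_natrec (a : Tm Γ A) (f : Tm Γ (Ty.nat ⇾ A ⇾ A)) (k : Tm Γ Ty.nat) :
    ⟪Tm.natrec a f k⟫ ρ = M.natrec (⟪a⟫ ρ) (⟪f⟫ ρ) (⟪k⟫ ρ) := by
  obtain ⟨n, σ, hσ⟩ := exists_represents_at ρ
  simp only [interp_eq_mk hσ, M.mk_natrec, Tm.sub_natrec]

@[simp] theorem interp_eq (a b : Tm Γ A) : ⟪a ≐ b⟫ ρ = M.eq (⟪a⟫ ρ) (⟪b⟫ ρ) := by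
  obtain ⟨n, σ, hσ⟩ := exists_represents_at ρ
  simp only [interp_eq_mk hσ, M.mk_eq, Tm.sub_eq]

@[simp] theorem interp_fls : ⟪Tm.fls⟫ ρ = M.fls := by
  obtain ⟨n, σ, hσ⟩ := exists_represents_at ρ
  simp only [interp_eq_mk hσ, M.mk_fls n, Tm.sub_fls]

-- The β-rule in semantic form. It lets operations of the model be written as λ-terms and evaluated
-- by extending the environment.
@[simp] theorem interp_lam_app (b : Tm (A :: Γ) B) (a : M A) :
    ⟪Tm.lam A b⟫ ρ ◃ a = ⟪b⟫ (a ∷ ρ) := by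
  obtain ⟨n, σ, hσ⟩ := exists_represents_at (a ∷ ρ)
  have hρ : Represents n (fun B x => σ B (Var.there x)) ρ := fun B x => hσ B (Var.there x)
  have hc : σ = Sub.cons (σ A Var.here) (fun B x => σ B (Var.there x)) := by
    funext B x; cases x <;> rfl
  have ha : M.mk n (σ A Var.here) = a := hσ A Var.here
  rw [interp_eq_mk hσ, interp_eq_mk hρ, ← ha, M.mk_app, M.mk_eq_iff, Tm.sub_lam]
  have := Derives.beta (H := []) (b.sub (Sub.lift A fun B x => σ B (Var.there x))) (σ A Var.here)
  rwa [Tm.sub_lift_inst, ← hc] at this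

theorem M.exists_mk₂ (a : M A) (b : M B) : ∃ n s t, M.mk n s = a ∧ M.mk n t = b := by
  obtain ⟨n, h⟩ := a.exists_mk
  obtain ⟨m, h'⟩ := b.exists_mk
  obtain ⟨s, hs⟩ := h _ (le_max_left n m)
  obtain ⟨t, ht⟩ := h' _ (le_max_right n m)
  exact ⟨_, s, t, hs, ht⟩

@[simp] theorem M.fst_pair (a : M A) (b : M B) : M.fst (M.pair a b) = a := by
  obtain ⟨n, s, t, rfl, rfl⟩ := M.exists_mk₂ a b
  rw [M.mk_pair, M.mk_fst, M.mk_eq_iff]; exact .fst_pair _ _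

@[simp] theorem M.snd_pair (a : M A) (b : M B) : M.snd (M.pair a b) = b := by
  obtain ⟨n, s, t, rfl, rfl⟩ := M.exists_mk₂ a b
  rw [M.mk_pair, M.mk_snd, M.mk_eq_iff]; exact .snd_pair _ _

@[simp] theorem M.pair_eta (a : M (Ty.prod A B)) : M.pair (M.fst a) (M.snd a) = a := by
  obtain ⟨n, s, _, rfl, -⟩ := M.exists_mk₂ a a
  rw [M.mk_fst, M.mk_snd, M.mk_pair, M.mk_eq_iff]; exact .pair_eta _

@[simp] theorem M.natrec_zero (a : M A) (f : M (Ty.nat ⇾ A ⇾ A)) :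
    M.natrec a f M.zero = a := by
  obtain ⟨n, s, t, rfl, rfl⟩ := M.exists_mk₂ a f
  rw [M.mk_zero n, M.mk_natrec, M.mk_eq_iff]; exact .natrec_zero _ _

@[simp] theorem M.natrec_succ (a : M A) (f : M (Ty.nat ⇾ A ⇾ A)) (k : M Ty.nat) :
    M.natrec a f (M.succ k) = f ◃ k ◃ M.natrec a f k := by
  obtain ⟨n, σ, hσ⟩ := exists_represents_at (k ∷ f ∷ a ∷ Env.nil)
  have ha := hσ _ (Var.there (Var.there Var.here))
  have hf := hσ _ (Var.there Var.here)
  have hk := hσ _ Var.here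
  simp only [Env.cons_here, Env.cons_there] at ha hf hk
  rw [← ha, ← hf, ← hk, M.mk_succ, M.mk_natrec, M.mk_natrec, M.mk_app, M.mk_app, M.mk_eq_iff]
  exact .natrec_succ _ _ _

end

/-! ### Forcing -/

section

variable {Γ : Ctx} {A B : Ty}

/-- The truth value `p` follows from the truth value `c`. -/
def Forces (c p : M Ty.omega) : Prop :=
  ∃ n c' p', M.mk n c' = c ∧ M.mk n p' = p ∧ Derives [c'] p'

infix:45 " ⊩ " => Forces

theorem Derives.head {H : List (Tm Γ Ty.omega)} {p : Tm Γ Ty.omega} : Derives (p :: H) p :=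
  .hyp (List.mem_cons_self ..)

theorem Derives.head_left {H : List (Tm Γ Ty.omega)} {p q : Tm Γ Ty.omega} :
    Derives ((p ⋏ q) :: H) p :=
  Derives.head.and_left

theorem Derives.head_right {H : List (Tm Γ Ty.omega)} {p q : Tm Γ Ty.omega} :
    Derives ((p ⋏ q) :: H) q :=
  Derives.head.and_right

theorem Derives.cut {H : List (Tm Γ Ty.omega)} {p q : Tm Γ Ty.omega} (h : Derives H p)
    (h' : Derives [p] q) : Derives H q :=
  .imp_elim ((Derives.imp_intro h').weaken (by simp)) h

theorem forces_mk {n : ℕ} {c p : Tm (level n) Ty.omega} :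
    M.mk n c ⊩ M.mk n p ↔ Derives [c] p := by
  constructor
  · rintro ⟨m, c', p', hc, hp, d⟩
    have hn := le_max_left n m
    have hm := le_max_right n m
    rw [← M.mk_up hn, ← M.mk_up hm, M.mk_eq_iff] at hc hp
    refine Derives.of_up hn ?_
    refine Derives.eq_mp (hp.weaken (by simp)) ((Derives.eq_mp (hc.eq_symm.weaken (by simp))
      (.hyp (List.mem_cons_self ..))).cut ?_)
    simpa using d.up hm
  · exact fun d => ⟨n, c, p, rfl, rfl, d⟩

/-- Truth values, as stages of forcing, are ordered by entailment. -/
instance : Preorder (M Ty.omega) where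
  le d c := d ⊩ c
  le_refl c := by
    obtain ⟨n, s, _, rfl, -⟩ := M.exists_mk₂ c c
    exact forces_mk.2 (.hyp (by simp))
  le_trans a b c h h' := by
    obtain ⟨n, σ, hσ⟩ := exists_represents_at (c ∷ b ∷ a ∷ Env.nil)
    have ha := hσ _ (Var.there (Var.there Var.here))
    have hb := hσ _ (Var.there Var.here)
    have hc := hσ _ Var.here
    simp only [Env.cons_here, Env.cons_there] at ha hb hc
    rw [← ha, ← hb, forces_mk] at h
    rw [← hb, ← hc, forces_mk] at h'
    rw [← ha, ← hc, forces_mk]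
    exact h.cut h'

theorem Forces.mono {c d p : M Ty.omega} (h : c ⊩ p) (hd : d ≤ c) : d ⊩ p := le_trans hd h

variable {c d : M Ty.omega} {ρ : Env Γ}

/-- The level can be chosen so that the next parameter has type `A`; this is why every type occurs
infinitely often among the parameters. That parameter serves as the eigenvariable in the quantifier
rules. -/
theorem exists_represents₂ (c r : M Ty.omega) (ρ : Env Γ) (A : Ty) :
    ∃ n σ c' r', Represents n σ ρ ∧ M.mk n c' = c ∧ M.mk n r' = r ∧ paramTy n = A := by
  obtain ⟨n, h⟩ := exists_represents (c ∷ r ∷ ρ)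
  obtain ⟨m, hm, hA⟩ := exists_paramTy A n
  obtain ⟨s, hs⟩ := h m hm
  exact ⟨m, fun B x => s B (Var.there (Var.there x)), s _ Var.here, s _ (Var.there Var.here),
    fun B x => hs B (Var.there (Var.there x)), hs _ Var.here, hs _ (Var.there Var.here), hA⟩

theorem forces_and {p q : Tm Γ Ty.omega} : c ⊩ ⟪p ⋏ q⟫ ρ ↔ c ⊩ ⟪p⟫ ρ ∧ c ⊩ ⟪q⟫ ρ := by
  obtain ⟨n, σ, c', _, hσ, rfl, -, -⟩ := exists_represents₂ c c ρ Ty.nat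
  simp only [interp_eq_mk hσ, forces_mk, Tm.sub_and]
  exact ⟨fun h => ⟨h.and_left, h.and_right⟩, fun h => .and_intro h.1 h.2⟩

theorem forces_imp {p q : Tm Γ Ty.omega} :
    c ⊩ ⟪p ⇛ q⟫ ρ ↔ ∀ d ≤ c, d ⊩ ⟪p⟫ ρ → d ⊩ ⟪q⟫ ρ := by
  constructor
  · intro h d hd hp
    replace h := h.mono hd
    obtain ⟨n, σ, d', _, hσ, rfl, -, -⟩ := exists_represents₂ d d ρ Ty.nat
    simp only [interp_eq_mk hσ, forces_mk, Tm.sub_imp] at h hp ⊢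
    exact h.imp_elim hp
  · intro h
    obtain ⟨n, σ, c', _, hσ, rfl, -, -⟩ := exists_represents₂ c c ρ Ty.nat
    -- The conjunction is the largest stage below `c` that forces the premise.
    have h' := h (M.mk n (c' ⋏ p.sub σ)) (forces_mk.2 .head_left)
    simp only [interp_eq_mk hσ, forces_mk, Tm.sub_imp] at h' ⊢
    refine .imp_intro (Derives.cut (.and_intro (.hyp (List.mem_cons_of_mem _ (List.mem_cons_self ..))) .head)
      (h' .head_right))

theorem Represents.cons_param {n : ℕ} {σ : Sub Γ (level n)} (hσ : Represents n σ ρ) :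
    Represents (n + 1) (σ.lift (paramTy n)) (M.mk (n + 1) (v0 : Tm (_ :: level n) _) ∷ ρ)
  | _, Var.here => rfl
  | _, Var.there x =>
    ((congrArg (M.mk (n + 1)) (Tm.up_succ (σ _ x)).symm).trans (M.mk_up _ _)).trans (hσ _ x)

theorem M.mk_wk {n : ℕ} (t : Tm (level n) A) :
    M.mk (n + 1) (t.wk (B := paramTy n)) = M.mk n t :=
  (congrArg (M.mk (n + 1)) (Tm.up_succ t).symm).trans (M.mk_up _ _)

theorem forces_all {p : Tm (A :: Γ) Ty.omega} :
    c ⊩ ⟪Tm.all A p⟫ ρ ↔ ∀ a : M A, c ⊩ ⟪p⟫ (a ∷ ρ) := by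
  constructor
  · intro h a
    obtain ⟨n, σ, c', _, hσ, rfl, -, -⟩ := exists_represents₂ c c (a ∷ ρ) Ty.nat
    have hρ : Represents n (fun B x => σ B (Var.there x)) ρ := fun B x => hσ B (Var.there x)
    have hc : σ = Sub.cons (σ A Var.here) (fun B x => σ B (Var.there x)) := by
      funext B x; cases x <;> rfl
    rw [interp_eq_mk hρ, forces_mk, Tm.sub_all] at h
    rw [interp_eq_mk hσ, forces_mk, hc, ← Tm.sub_lift_inst]
    exact h.all_elim _
  · intro h
    obtain ⟨n, σ, c', _, hσ, rfl, -, rfl⟩ := exists_represents₂ c c ρ A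
    -- The next parameter is a generic element: what is forced of it at a stage not mentioning it is
    -- the premise of `all_intro`.
    have h' := h (M.mk (n + 1) (v0 : Tm (_ :: level n) _))
    rw [interp_eq_mk hσ.cons_param, ← M.mk_wk] at h'
    rw [interp_eq_mk hσ, forces_mk]
    exact .all_intro (forces_mk.1 h')

/-- The property `P` of stages holds locally at `c`: every truth value that it forces at all
smaller stages is forced at `c`. -/
def Loc (c : M Ty.omega) (P : M Ty.omega → Prop) : Prop :=
  ∀ r, (∀ d ≤ c, P d → d ⊩ r) → c ⊩ r

theorem Loc.pure {P : M Ty.omega → Prop} (h : P c) : Loc c P := fun _ hr => hr c le_rfl h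

/-- With `Loc.pure` this makes `Loc` a monad: a local witness may be used as an actual one as long
as the goal is local. Forcing goals are local too, by applying `Loc` to them directly. -/
theorem Loc.bind {P Q : M Ty.omega → Prop} (h : Loc c P) (h' : ∀ d ≤ c, P d → Loc d Q) :
    Loc c Q :=
  fun r hr => h r fun d hd hp => h' d hd hp r fun e he hq => hr e (le_trans he hd) hq

theorem Loc.imp {P Q : M Ty.omega → Prop} (h : Loc c P) (h' : ∀ d ≤ c, P d → Q d) : Loc c Q :=
  h.bind fun d hd hp => .pure (h' d hd hp)

/-- A property of stages that passes to smaller stages. -/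
class Persistent (P : M Ty.omega → Prop) : Prop where
  down : ∀ {c d : M Ty.omega}, d ≤ c → P c → P d

theorem down {P : M Ty.omega → Prop} [Persistent P] (hd : d ≤ c) (h : P c) : P d :=
  Persistent.down hd h

instance {p : M Ty.omega} : Persistent fun c => c ⊩ p := ⟨fun hd h => h.mono hd⟩

instance {ι : Sort*} {P : ι → M Ty.omega → Prop} [∀ i, Persistent (P i)] :
    Persistent fun c => ∃ i, P i c := ⟨fun hd ⟨i, h⟩ => ⟨i, down hd h⟩⟩

instance {P Q : M Ty.omega → Prop} [Persistent P] [Persistent Q] :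
    Persistent fun c => P c ∧ Q c := ⟨fun hd h => ⟨down hd h.1, down hd h.2⟩⟩

instance {P Q : M Ty.omega → Prop} [Persistent P] [Persistent Q] :
    Persistent fun c => P c ∨ Q c := ⟨fun hd h => h.imp (down hd) (down hd)⟩

/-- The test value `r` is only related to the smaller stage `d`, so the hypothesis at `c` cannot be
applied to it. It is applied to the implication from `d` to `r` instead. -/
instance {P : M Ty.omega → Prop} [Persistent P] : Persistent fun c => Loc c P where
  down {c d} hd h r hr := by
    have h' : c ⊩ ⟪v1 ⇛ v0⟫ (r ∷ d ∷ Env.nil) := h _ fun e he hp =>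
      forces_imp.2 fun f hf hfd => by
        simp only [v0, v1, interp_var, Env.cons_here, Env.cons_there] at hfd ⊢
        exact hr f hfd (down hf hp)
    have h2 := forces_imp.1 h' d hd
    simp only [v0, v1, interp_var, Env.cons_here, Env.cons_there] at h2
    exact h2 (le_refl d)

theorem Loc.mono {P : M Ty.omega → Prop} [Persistent P] (h : Loc c P) (hd : d ≤ c) : Loc d P :=
  down (P := fun c => Loc c P) hd h

theorem forces_ex {p : Tm (A :: Γ) Ty.omega} :
    c ⊩ ⟪Tm.ex A p⟫ ρ ↔ Loc c fun d => ∃ a : M A, d ⊩ ⟪p⟫ (a ∷ ρ) := by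
  constructor
  · intro h r hr
    obtain ⟨n, σ, c', r', hσ, rfl, rfl, rfl⟩ := exists_represents₂ c r ρ A
    -- The test stage adds to `c` the assumption that the next parameter is a witness. As `c` and
    -- `r` do not mention this parameter, the result is the premise of `ex_elim`.
    have h1 : M.mk (n + 1) (c'.wk (B := paramTy n) ⋏ p.sub (σ.lift (paramTy n))) ≤ M.mk n c' :=
      le_of_le_of_eq (forces_mk.2 Derives.head_left : _ ⊩ M.mk (n + 1) c'.wk) (M.mk_wk c')
    have h2 : M.mk (n + 1) (c'.wk (B := paramTy n) ⋏ p.sub (σ.lift (paramTy n))) ⊩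
        M.mk (n + 1) (p.sub (σ.lift (paramTy n))) := forces_mk.2 Derives.head_right
    rw [← interp_eq_mk hσ.cons_param] at h2
    have h' := hr _ h1 ⟨_, h2⟩
    rw [← M.mk_wk r'] at h'
    replace h' := forces_mk.1 h'
    rw [interp_eq_mk hσ, forces_mk] at h
    rw [forces_mk]
    exact h.ex_elim (Derives.cut (.and_intro (.hyp (List.mem_cons_of_mem _ (List.mem_cons_self ..))) .head) h')
  · intro h
    -- Locality is tested against the existential statement itself.
    refine h _ fun d _ ⟨a, ha⟩ => ?_
    obtain ⟨n, σ, d', _, hσ, rfl, -, -⟩ := exists_represents₂ d d (a ∷ ρ) Ty.nat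
    have hρ : Represents n (fun B x => σ B (Var.there x)) ρ := fun B x => hσ B (Var.there x)
    have hc : σ = Sub.cons (σ A Var.here) (fun B x => σ B (Var.there x)) := by
      funext B x; cases x <;> rfl
    rw [interp_eq_mk hσ, forces_mk, hc, ← Tm.sub_lift_inst] at ha
    rw [interp_eq_mk hρ, forces_mk, Tm.sub_ex]
    exact ha.ex_intro

theorem forces_or {p q : Tm Γ Ty.omega} :
    c ⊩ ⟪p ⋎ q⟫ ρ ↔ Loc c fun d => d ⊩ ⟪p⟫ ρ ∨ d ⊩ ⟪q⟫ ρ := by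
  constructor
  · intro h r hr
    obtain ⟨n, σ, c', r', hσ, rfl, rfl, -⟩ := exists_represents₂ c r ρ Ty.nat
    have h1 := hr (M.mk n (c' ⋏ p.sub σ)) (forces_mk.2 .head_left)
    have h2 := hr (M.mk n (c' ⋏ q.sub σ)) (forces_mk.2 .head_left)
    simp only [interp_eq_mk hσ, forces_mk, Tm.sub_or] at h h1 h2 ⊢
    refine .or_elim h
      (Derives.cut (.and_intro (.hyp (List.mem_cons_of_mem _ (List.mem_cons_self ..))) .head) (h1 (.inl ?_)))
      (Derives.cut (.and_intro (.hyp (List.mem_cons_of_mem _ (List.mem_cons_self ..))) .head) (h2 (.inr ?_)))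
    all_goals exact .head_right
  · intro h
    refine h _ fun d _ h => ?_
    obtain ⟨n, σ, d', _, hσ, rfl, -, -⟩ := exists_represents₂ d d ρ Ty.nat
    simp only [interp_eq_mk hσ, forces_mk, Tm.sub_or] at h ⊢
    exact h.elim .or_inl .or_inr

theorem forces_fls (h : c ⊩ M.fls) (p : M Ty.omega) : c ⊩ p := by
  obtain ⟨n, s, t, rfl, rfl⟩ := M.exists_mk₂ c p
  rw [M.mk_fls n, forces_mk] at h
  exact forces_mk.2 h.fls_elim

theorem Loc.of_fls {P : M Ty.omega → Prop} (h : c ⊩ M.fls) : Loc c P := fun r _ => forces_fls h r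

/-- The truth value `p` is refuted at the stage `c`. -/
def Refutes (c p : M Ty.omega) : Prop := ∀ d ≤ c, d ⊩ p → d ⊩ M.fls

infix:45 " ⊮ " => Refutes

theorem Refutes.mono {p : M Ty.omega} (h : c ⊮ p) (hd : d ≤ c) : d ⊮ p :=
  fun e he => h e (le_trans he hd)

theorem Refutes.elim {p : M Ty.omega} (h : c ⊮ p) (hp : c ⊩ p) (q : M Ty.omega) : c ⊩ q :=
  forces_fls (h c le_rfl hp) q

instance {p : M Ty.omega} : Persistent fun c => c ⊮ p := ⟨fun hd h => h.mono hd⟩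

theorem forces_neg {p : Tm Γ Ty.omega} : c ⊩ ⟪p.neg⟫ ρ ↔ c ⊮ ⟪p⟫ ρ := by
  rw [Tm.neg, forces_imp, Refutes]; simp

theorem forces_iff {p q : Tm Γ Ty.omega} :
    c ⊩ ⟪p.iff q⟫ ρ ↔
      (∀ d ≤ c, d ⊩ ⟪p⟫ ρ → d ⊩ ⟪q⟫ ρ) ∧ ∀ d ≤ c, d ⊩ ⟪q⟫ ρ → d ⊩ ⟪p⟫ ρ := by
  rw [Tm.iff, forces_and, forces_imp, forces_imp]

/-! ### Equality in the generic model -/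

theorem forces_eq_refl (c : M Ty.omega) (a : M A) : c ⊩ M.eq a a := by
  obtain ⟨n, s, t, rfl, rfl⟩ := M.exists_mk₂ c a
  rw [M.mk_eq, forces_mk]
  exact .eq_refl _

theorem Forces.subst {a b : M A} (h : c ⊩ M.eq a b) (p : Tm (A :: Γ) Ty.omega)
    (hp : c ⊩ ⟪p⟫ (a ∷ ρ)) : c ⊩ ⟪p⟫ (b ∷ ρ) := by
  obtain ⟨n, σ, c', _, hσ, rfl, -, -⟩ := exists_represents₂ c c (b ∷ a ∷ ρ) Ty.nat
  have ha := hσ _ (Var.there Var.here)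
  have hb := hσ _ Var.here
  have hρ : Represents n (fun B x => σ B (Var.there (Var.there x))) ρ :=
    fun B x => hσ B (Var.there (Var.there x))
  simp only [Env.cons_here, Env.cons_there] at ha hb
  rw [← ha, ← hb, M.mk_eq, forces_mk] at h
  rw [interp_eq_mk (hρ.cons ha), forces_mk, ← Tm.sub_lift_inst] at hp
  rw [interp_eq_mk (hρ.cons hb), forces_mk, ← Tm.sub_lift_inst]
  exact h.eq_subst _ hp

theorem Forces.congr {a b : M A} (h : c ⊩ M.eq a b) (t : Tm (A :: Γ) B) :
    c ⊩ M.eq (⟪t⟫ (a ∷ ρ)) (⟪t⟫ (b ∷ ρ)) := by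
  -- The predicate is `t(a) = t(x)` in `x`, with the fixed value `t(a)` stored in an extra variable
  -- of the environment.
  have h' := h.subst (ρ := ⟪t⟫ (a ∷ ρ) ∷ ρ)
    (v1 ≐ t.sub (Sub.cons v0 fun B x => Tm.var (Var.there (Var.there x))))
  simp only [interp_eq, interp_sub_cons, v0, v1, interp_var, Env.cons_here, Env.cons_there] at h'
  exact h' (forces_eq_refl _ _)

theorem Forces.eq_mp {p q : M Ty.omega} (h : c ⊩ M.eq p q) (hp : c ⊩ p) : c ⊩ q := by
  have h' := h.subst (ρ := Env.nil) v0
  simp only [v0, interp_var, Env.cons_here] at h'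
  exact h' hp

theorem Forces.symm {a b : M A} (h : c ⊩ M.eq a b) : c ⊩ M.eq b a := by
  have h' := h.subst (ρ := a ∷ Env.nil) (v0 ≐ v1)
  simp only [interp_eq, v0, v1, interp_var, Env.cons_here, Env.cons_there] at h'
  exact h' (forces_eq_refl _ _)

theorem Forces.trans {a b e : M A} (h : c ⊩ M.eq a b) (h' : c ⊩ M.eq b e) : c ⊩ M.eq a e := by
  have h' := h'.subst (ρ := a ∷ Env.nil) (v1 ≐ v0)
  simp only [interp_eq, v0, v1, interp_var, Env.cons_here, Env.cons_there] at h'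
  exact h' h

theorem Forces.eq_mpr {p q : M Ty.omega} (h : c ⊩ M.eq p q) (hq : c ⊩ q) : c ⊩ p :=
  h.symm.eq_mp hq

theorem Forces.app_arg {a b : M A} (h : c ⊩ M.eq a b) (f : M (A ⇾ B)) :
    c ⊩ M.eq (f ◃ a) (f ◃ b) := by
  have h' := h.congr (ρ := f ∷ Env.nil) (v1 ⬝ v0)
  simpa [v0, v1] using h'

theorem Forces.app_fun {f g : M (A ⇾ B)} (h : c ⊩ M.eq f g) (a : M A) :
    c ⊩ M.eq (f ◃ a) (g ◃ a) := by
  have h' := h.congr (ρ := a ∷ Env.nil) (v0 ⬝ v1)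
  simpa [v0, v1] using h'

theorem Forces.succ {m n : M Ty.nat} (h : c ⊩ M.eq m n) : c ⊩ M.eq m.succ n.succ := by
  have h' := h.congr (ρ := Env.nil) (Tm.succ v0)
  simpa [v0, v1] using h'

theorem Forces.fst {a b : M (Ty.prod A B)} (h : c ⊩ M.eq a b) : c ⊩ M.eq a.fst b.fst := by
  have h' := h.congr (ρ := Env.nil) (Tm.fst v0)
  simpa [v0, v1] using h'

theorem Forces.snd {a b : M (Ty.prod A B)} (h : c ⊩ M.eq a b) : c ⊩ M.eq a.snd b.snd := by
  have h' := h.congr (ρ := Env.nil) (Tm.snd v0)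
  simpa [v0, v1] using h'

theorem Forces.pair {a a' : M A} {b b' : M B} (h : c ⊩ M.eq a a') (h' : c ⊩ M.eq b b') :
    c ⊩ M.eq (a.pair b) (a'.pair b') := by
  have h1 := h.congr (ρ := b ∷ Env.nil) (Tm.pair v0 v1)
  have h2 := h'.congr (ρ := a' ∷ Env.nil) (Tm.pair v1 v0)
  simp [v0, v1] at h1 h2
  exact h1.trans h2

theorem forces_prop_ext {p q : M Ty.omega} (h : ∀ d ≤ c, d ⊩ p → d ⊩ q)
    (h' : ∀ d ≤ c, d ⊩ q → d ⊩ p) : c ⊩ M.eq p q := by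
  have h1 : c ⊩ ⟪v1 ⇛ v0⟫ (q ∷ p ∷ Env.nil) := forces_imp.2 (by simpa [v0, v1] using h)
  have h2 : c ⊩ ⟪v0 ⇛ v1⟫ (q ∷ p ∷ Env.nil) := forces_imp.2 (by simpa [v0, v1] using h')
  suffices c ⊩ ⟪v1 ≐ v0⟫ (q ∷ p ∷ Env.nil) by simpa [v0, v1] using this
  obtain ⟨n, σ, c', _, hσ, rfl, -, -⟩ := exists_represents₂ c c (q ∷ p ∷ Env.nil) Ty.nat
  rw [interp_eq_mk hσ, forces_mk] at h1 h2 ⊢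
  exact .prop_ext h1 h2

theorem forces_fun_ext {f g : M (A ⇾ B)} (h : ∀ a, c ⊩ M.eq (f ◃ a) (g ◃ a)) :
    c ⊩ M.eq f g := by
  have h1 : c ⊩ ⟪Tm.all A ((v1 : Tm [A ⇾ B, A ⇾ B] _).wk ⬝ v0 ≐ v0.wk ⬝ v0)⟫
      (g ∷ f ∷ Env.nil) := forces_all.2 (by simpa [v0, v1] using h)
  suffices c ⊩ ⟪v1 ≐ v0⟫ (g ∷ f ∷ Env.nil) by simpa [v0, v1] using this
  obtain ⟨n, σ, c', _, hσ, rfl, -, -⟩ := exists_represents₂ c c (g ∷ f ∷ Env.nil) Ty.nat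
  rw [interp_eq_mk hσ, forces_mk] at h1 ⊢
  simp only [Tm.sub_all, Tm.sub_eq, Tm.sub_app, Tm.wk_sub_lift] at h1
  exact .fun_ext h1

/-! ### Natural numbers in the generic model -/

theorem forces_succ_ne_zero {n : M Ty.nat} (h : c ⊩ M.eq n.succ M.zero) : c ⊩ M.fls := by
  obtain ⟨k, s, t, rfl, rfl⟩ := M.exists_mk₂ c n
  rw [M.mk_succ, M.mk_zero k, M.mk_eq, forces_mk] at h
  rw [M.mk_fls k, forces_mk]
  exact (Derives.succ_ne_zero _).imp_elim h

theorem forces_succ_inj {m n : M Ty.nat} (h : c ⊩ M.eq m.succ n.succ) : c ⊩ M.eq m n := by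
  suffices c ⊩ ⟪v1 ≐ v0⟫ (n ∷ m ∷ Env.nil) by simpa [v0, v1] using this
  replace h : c ⊩ ⟪Tm.succ v1 ≐ Tm.succ v0⟫ (n ∷ m ∷ Env.nil) := by simpa [v0, v1] using h
  obtain ⟨n, σ, c', _, hσ, rfl, -, -⟩ := exists_represents₂ c c (n ∷ m ∷ Env.nil) Ty.nat
  rw [interp_eq_mk hσ, forces_mk] at h ⊢
  exact (Derives.succ_inj _ _).imp_elim h

/-- `M Ty.nat` contains terms with parameters, so it has no induction in Lean; only properties given
by formulas can be proved inductively. This is why semantic notions below have formula counterparts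
such as `zerosF` and `diagonalF`. -/
theorem forces_induction (p : Tm (Ty.nat :: Γ) Ty.omega) (h0 : c ⊩ ⟪p⟫ (M.zero ∷ ρ))
    (hs : ∀ n, ∀ d ≤ c, d ⊩ ⟪p⟫ (n ∷ ρ) → d ⊩ ⟪p⟫ (n.succ ∷ ρ)) (n : M Ty.nat) :
    c ⊩ ⟪p⟫ (n ∷ ρ) := by
  have h1 : c ⊩ ⟪v0 ⬝ Tm.zero⟫ (⟪Tm.lam _ p⟫ ρ ∷ Env.nil) := by simpa [v0] using h0
  have h2 : c ⊩ ⟪Tm.all Ty.nat (v0.wk ⬝ v0 ⇛ v0.wk ⬝ Tm.succ v0)⟫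
      (⟪Tm.lam _ p⟫ ρ ∷ Env.nil) :=
    forces_all.2 fun n => forces_imp.2 (by simpa [v0] using hs n)
  have h3 : c ⊩ ⟪Tm.all Ty.nat (v0.wk ⬝ v0)⟫ (⟪Tm.lam _ p⟫ ρ ∷ Env.nil) := by
    obtain ⟨n, σ, c', _, hσ, rfl, -, -⟩ :=
      exists_represents₂ c c (⟪Tm.lam _ p⟫ ρ ∷ Env.nil) Ty.nat
    rw [interp_eq_mk hσ, forces_mk] at h1 h2 ⊢
    simp only [Tm.sub_all, Tm.sub_imp, Tm.sub_app, Tm.wk_sub_lift] at h2 ⊢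
    exact .induction _ h1 h2
  simpa [v0] using forces_all.1 h3 n

/-! ### Completeness -/

theorem derives_of_forces {H : List Sentence} {p : Sentence}
    (h : ∀ c, (∀ q ∈ H, c ⊩ ⟪q⟫ Env.nil) → c ⊩ ⟪p⟫ Env.nil) : Derives H p := by
  have hconj : ∃ q : Sentence, Derives H q ∧ ∀ r ∈ H, Derives [q] r := by
    clear h
    induction H with
    | nil => exact ⟨Tm.fls ⇛ Tm.fls, .imp_intro (.hyp (by simp)), by simp⟩
    | cons a H ih =>
      obtain ⟨q, hq, hr⟩ := ih
      refine ⟨a ⋏ q, .and_intro .head (hq.weaken (by simp)), fun r hr' => ?_⟩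
      rcases List.mem_cons.1 hr' with rfl | hr'
      · exact .head_left
      · exact Derives.cut .head_right (hr r hr')
  obtain ⟨q, hq, hr⟩ := hconj
  have e : ∀ p : Sentence, ⟪p⟫ Env.nil = M.mk 0 p := by
    intro p
    have hs : Represents (Γ := []) 0 (fun _ x => Tm.var x) Env.nil := fun _ x => nomatch x
    exact (interp_eq_mk hs p).trans (congrArg (M.mk 0) p.sub_id)
  -- The conjunction `q` of the hypotheses, taken as a stage, forces each of them, and forcing at
  -- `q` is derivability from `q`.
  have h' := h (M.mk 0 q) fun r hr' => by rw [e]; exact forces_mk.2 (hr r hr')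
  rw [e] at h'
  exact hq.cut (forces_mk.1 h')

end

section

attribute [local simp] v0 v1 v2 v3 v4 forces_and forces_imp forces_all forces_ex forces_or
  forces_neg forces_iff forces_eq_refl

variable {Γ : Ctx} {A B : Ty} {c d : M Ty.omega} {ρ : Env Γ}

/-! ### Choice -/

theorem dependent_choice (hc : c ⊩ ⟪dependentChoice A⟫ Env.nil) (X : M (A ⇾ Ty.omega))
    (R : M (A ⇾ A ⇾ Ty.omega))
    (h : ∀ a, ∀ d ≤ c, d ⊩ X ◃ a → Loc d fun e => ∃ b, e ⊩ X ◃ b ∧ e ⊩ R ◃ a ◃ b)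
    {a : M A} (ha : c ⊩ X ◃ a) :
    Loc c fun d => ∃ f : M (Ty.nat ⇾ A), d ⊩ M.eq (f ◃ M.zero) a ∧
      ∀ n, d ⊩ X ◃ (f ◃ n) ∧ d ⊩ R ◃ (f ◃ n) ◃ (f ◃ M.succ n) := by
  simp [dependentChoice] at hc
  exact hc X R c le_rfl h a c le_rfl ha

/-- Dependent choice is applied to pairs (n, b) with R(n, b), a successor of (n, b) being any such
pair with first component n + 1. This explains the type `Ty.prod Ty.nat B` in the hypothesis. -/
theorem countable_choice (hc : c ⊩ ⟪dependentChoice (Ty.prod Ty.nat B)⟫ Env.nil)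
    (R : M (Ty.nat ⇾ B ⇾ Ty.omega)) (h : ∀ n, Loc c fun d => ∃ b, d ⊩ R ◃ n ◃ b) :
    Loc c fun d => ∃ f : M (Ty.nat ⇾ B), ∀ n, d ⊩ R ◃ n ◃ (f ◃ n) := by
  refine (h M.zero).bind fun d hd ⟨b, hb⟩ => ?_
  refine (dependent_choice (hc.mono hd)
    (⟪Tm.lam (Ty.prod Ty.nat B) (v1 ⬝ Tm.fst v0 ⬝ Tm.snd v0)⟫ (R ∷ Env.nil))
    (⟪Tm.lam (Ty.prod Ty.nat B) (Tm.lam (Ty.prod Ty.nat B)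
      (Tm.fst v0 ≐ Tm.succ (Tm.fst v1)))⟫ Env.nil)
    (fun a e he _ => ?_) (a := M.pair M.zero b) (by simpa using hb)).imp ?_
  · exact ((h a.fst.succ).mono (he.trans hd)).imp fun f _ ⟨b, hb⟩ =>
      ⟨M.pair a.fst.succ b, by simpa using hb, by simp⟩
  · rintro e he ⟨f, hf0, hf⟩
    simp at hf
    have key : ∀ n, e ⊩ M.eq (M.fst (f ◃ n)) n := by
      intro n
      have := forces_induction (ρ := f ∷ Env.nil) (c := e) (Tm.fst (v1 ⬝ v0) ≐ v0) ?_ ?_ n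
      · simpa using this
      · simpa using hf0.fst
      · intro n g hg h
        simp at h ⊢
        exact ((hf n).2.mono hg).trans h.succ
    refine ⟨⟪Tm.lam Ty.nat (Tm.snd (v1 ⬝ v0))⟫ (f ∷ Env.nil), fun n => ?_⟩
    simp only [interp_lam_app]
    simp
    exact (((key n).app_arg R).app_fun _).eq_mp (hf n).1

/-! ### Decidable truth values -/

/-- The truth value `p` is decidable at the stage `c`. -/
def Dec (c p : M Ty.omega) : Prop := Loc c fun d => d ⊩ p ∨ d ⊮ p

theorem Dec.mono {p : M Ty.omega} (h : Dec c p) (hd : d ≤ c) : Dec d p := Loc.mono h hd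

theorem Dec.of_forces {p : M Ty.omega} (h : c ⊩ p) : Dec c p := .pure (.inl h)

theorem Dec.of_refutes {p : M Ty.omega} (h : c ⊮ p) : Dec c p := .pure (.inr h)

theorem Dec.and {p q : Tm Γ Ty.omega} (hp : Dec c (⟪p⟫ ρ)) (hq : Dec c (⟪q⟫ ρ)) :
    Dec c (⟪p ⋏ q⟫ ρ) := by
  refine hp.bind fun d hd h => ?_
  rcases h with h | h
  · refine (hq.mono hd).imp fun e he h' => ?_
    rcases h' with h' | h'
    · exact .inl (forces_and.2 ⟨h.mono he, h'⟩)
    · exact .inr fun f hf hfp => h' f hf (forces_and.1 hfp).2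
  · exact .pure (.inr fun f hf hfp => h f hf (forces_and.1 hfp).1)

theorem Dec.neg {p : Tm Γ Ty.omega} (hp : Dec c (⟪p⟫ ρ)) : Dec c (⟪p.neg⟫ ρ) := by
  refine hp.imp fun d hd h => ?_
  rcases h with h | h
  · exact .inr fun e he hp => (forces_neg.1 hp) e le_rfl (h.mono he)
  · exact .inl (forces_neg.2 h)

theorem Dec.stable {p : M Ty.omega} (hp : Dec c p) (h : ∀ d ≤ c, d ⊮ p → d ⊩ M.fls) : c ⊩ p :=
  hp _ fun d hd h' => h'.elim id fun h' => forces_fls (h d hd h') _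

theorem nat_cases (c : M Ty.omega) (n : M Ty.nat) :
    Loc c fun d => d ⊩ M.eq n M.zero ∨ ∃ m, d ⊩ M.eq n (M.succ m) := by
  have h := forces_induction (ρ := Env.nil) (c := c)
    (v0 ≐ Tm.zero ⋎ Tm.ex Ty.nat (v1 ≐ Tm.succ v0)) ?_ ?_ n
  · simp at h
    refine h.bind fun d _ h => ?_
    rcases h with h | h
    · exact .pure (.inl h)
    · exact h.imp fun _ _ h => .inr h
  · exact forces_or.2 (.pure (.inl (by simp)))
  · intro n d _ _
    simp
    exact .pure (.inr (.pure ⟨n, forces_eq_refl _ _⟩))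

theorem nat_dec (c : M Ty.omega) (m n : M Ty.nat) : Dec c (M.eq m n) := by
  have h := forces_induction (ρ := Env.nil) (c := c)
    (Tm.all Ty.nat (v1 ≐ v0 ⋎ Tm.neg (v1 ≐ v0))) ?_ ?_ m
  · simp at h
    exact h n
  · simp
    intro n
    refine (nat_cases c n).imp fun d _ h => ?_
    rcases h with h | ⟨k, h⟩
    · exact .inl h.symm
    · exact .inr fun e he h' => forces_succ_ne_zero ((h.mono he).symm.trans h'.symm)
  · intro m d _ ih
    simp at ih ⊢
    intro n
    refine (nat_cases d n).bind fun e he h => ?_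
    rcases h with h | ⟨k, h⟩
    · exact .pure (.inr fun f hf h' => forces_succ_ne_zero (h'.trans (h.mono hf)))
    · refine ((ih k).mono he).imp fun f hf h' => ?_
      rcases h' with h' | h'
      · exact .inl (h'.succ.trans (h.mono hf).symm)
      · exact .inr fun g hg e => h' g hg (forces_succ_inj (e.trans (h.mono (hg.trans hf))))

theorem forces_ne_succ_self (n : M Ty.nat) : c ⊮ M.eq n n.succ := by
  have h := forces_induction (ρ := Env.nil) (c := c) (Tm.neg (v0 ≐ Tm.succ v0)) ?_ ?_ n
  · simpa using h
  · simp
    exact fun d _ h => forces_succ_ne_zero h.symm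
  · intro n d _ ih
    simp at ih ⊢
    exact fun e he h => ih e he (forces_succ_inj h)

end

section

attribute [local simp] v0 v1 v2 v3 v4 forces_and forces_imp forces_all forces_ex forces_or
  forces_neg forces_iff forces_eq_refl

variable {Γ : Ctx} {A B : Ty} {c d : M Ty.omega} {ρ : Env Γ}

theorem interp_const (t : Tm [] A) (s : Sub [] Γ) : ⟪t.sub s⟫ ρ = ⟪t⟫ Env.nil := by
  rw [interp_sub]
  congr 1
  funext B x
  cases x

/-! ### The order of the natural numbers -/

/-- The recursion step in the definition of the order. -/
def ltStep : Tm Γ (Ty.nat ⇾ Ty.nat ⇾ Ty.omega ⇾ Ty.omega) :=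
  Tm.lam Ty.nat (Tm.lam Ty.nat (Tm.lam Ty.omega (v0 ⋎ v2 ≐ v1)))

/-- The formula `s < t`. -/
def ltF (s t : Tm Γ Ty.nat) : Tm Γ Ty.omega := Tm.natrec Tm.fls (ltStep ⬝ s) t

/-- The order of the natural numbers in the generic model. -/
noncomputable def M.lt (m n : M Ty.nat) : M Ty.omega :=
  M.natrec M.fls (⟪ltStep⟫ Env.nil ◃ m) n

@[simp] theorem interp_ltF (s t : Tm Γ Ty.nat) : ⟪ltF s t⟫ ρ = M.lt (⟪s⟫ ρ) (⟪t⟫ ρ) := by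
  have h : ⟪ltStep⟫ ρ = ⟪ltStep⟫ Env.nil := interp_const (Γ := Γ) ltStep (fun _ x => nomatch x)
  simp [ltF, M.lt, h]

theorem forces_lt_zero {m : M Ty.nat} (h : c ⊩ M.lt m M.zero) : c ⊩ M.fls := by
  simpa [M.lt] using h

theorem forces_lt_succ {m n : M Ty.nat} :
    c ⊩ M.lt m n.succ ↔ Loc c fun d => d ⊩ M.lt m n ∨ d ⊩ M.eq m n := by
  simp [M.lt, ltStep]

theorem lt_succ_self (c : M Ty.omega) (n : M Ty.nat) : c ⊩ M.lt n n.succ :=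
  forces_lt_succ.2 (.pure (.inr (forces_eq_refl _ _)))

theorem lt_succ {m n : M Ty.nat} (h : c ⊩ M.lt m n) : c ⊩ M.lt m n.succ :=
  forces_lt_succ.2 (.pure (.inl h))

theorem lt_congr_left {m m' n : M Ty.nat} (h : c ⊩ M.lt m n) (e : c ⊩ M.eq m m') :
    c ⊩ M.lt m' n := by
  simpa using e.subst (ρ := n ∷ Env.nil) (ltF v0 v1) (by simpa using h)

theorem lt_congr_right {m n n' : M Ty.nat} (h : c ⊩ M.lt m n) (e : c ⊩ M.eq n n') :
    c ⊩ M.lt m n' := by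
  simpa using e.subst (ρ := m ∷ Env.nil) (ltF v1 v0) (by simpa using h)

theorem lt_trans {m n k : M Ty.nat} (h : c ⊩ M.lt m n) (h' : c ⊩ M.lt n k) : c ⊩ M.lt m k := by
  have key := forces_induction (ρ := n ∷ m ∷ Env.nil) (c := c)
    (ltF v1 v0 ⇛ ltF v2 v0) ?_ ?_ k
  · simp at key
    exact key c le_rfl h'
  · simp
    exact fun d _ h => forces_fls (forces_lt_zero h) _
  · intro k d hd ih
    simp at ih ⊢
    intro e he hk
    refine forces_lt_succ.1 hk _ fun f hf hk => ?_
    rcases hk with hk | hk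
    · exact lt_succ (ih f (hf.trans he) hk)
    · exact lt_succ (lt_congr_right (h.mono (hf.trans (he.trans hd))) hk)

theorem lt_irrefl (c : M Ty.omega) (n : M Ty.nat) : c ⊮ M.lt n n := by
  have key := forces_induction (ρ := Env.nil) (c := c) (Tm.neg (ltF v0 v0)) ?_ ?_ n
  · simpa using key
  · simp
    exact fun d _ h => forces_lt_zero h
  · intro n d _ ih
    simp at ih ⊢
    intro e he h
    refine forces_lt_succ.1 h _ fun f hf h => ?_
    rcases h with h | h
    · exact ih f (hf.trans he) (lt_trans (lt_succ_self f n) h)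
    · exact forces_ne_succ_self n f le_rfl h.symm

theorem zero_lt_succ (c : M Ty.omega) (n : M Ty.nat) : c ⊩ M.lt M.zero n.succ := by
  have key := forces_induction (ρ := Env.nil) (c := c) (ltF Tm.zero (Tm.succ v0)) ?_ ?_ n
  · simpa using key
  · simpa using lt_succ_self c M.zero
  · intro n d _ h
    simp at h ⊢
    exact lt_succ h

theorem succ_lt_succ {m n : M Ty.nat} (h : c ⊩ M.lt m n) : c ⊩ M.lt m.succ n.succ := by
  have key := forces_induction (ρ := m ∷ Env.nil) (c := c)
    (ltF v1 v0 ⇛ ltF (Tm.succ v1) (Tm.succ v0)) ?_ ?_ n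
  · simp at key
    exact key c le_rfl h
  · simp
    exact fun d _ h => forces_fls (forces_lt_zero h) _
  · intro n d _ ih
    simp at ih ⊢
    intro e he h
    refine forces_lt_succ.1 h _ fun f hf h => ?_
    rcases h with h | h
    · exact lt_succ (ih f (hf.trans he) h)
    · exact lt_congr_right (lt_succ_self f _) h.succ.succ

theorem lt_trichotomy (c : M Ty.omega) (m n : M Ty.nat) :
    Loc c fun d => d ⊩ M.lt m n ∨ d ⊩ M.eq m n ∨ d ⊩ M.lt n m := by
  have key := forces_induction (ρ := Env.nil) (c := c)
    (Tm.all Ty.nat (ltF v1 v0 ⋎ v1 ≐ v0 ⋎ ltF v0 v1)) ?_ ?_ m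
  · simp at key
    refine (key n).bind fun d _ h => ?_
    rcases h with h | h
    · exact .pure (.inl h)
    · exact h.imp fun _ _ h => .inr h
  · simp
    intro n
    refine (nat_cases c n).imp fun d _ h => ?_
    rcases h with h | ⟨k, h⟩
    · exact .inr (.pure (.inl h.symm))
    · exact .inl (lt_congr_right (zero_lt_succ d k) h.symm)
  · intro m d _ ih
    simp at ih ⊢
    intro n
    refine (nat_cases d n).bind fun e he h => ?_
    rcases h with h | ⟨k, h⟩
    · exact .pure (.inr (.pure (.inr (lt_congr_left (zero_lt_succ e m) h.symm))))
    · refine ((ih k).mono he).imp fun f hf h' => ?_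
      have h := (h.mono hf).symm
      rcases h' with h' | h'
      · exact .inl (lt_congr_right (succ_lt_succ h') h)
      · refine .inr (h'.imp fun g hg h' => ?_)
        rcases h' with h' | h'
        · exact .inl (h'.succ.trans (h.mono hg))
        · exact .inr (lt_congr_left (succ_lt_succ h') (h.mono hg))

/-! ### The first nonzero term of a sequence -/

/-- The formula stating that the terms of `b` before `n` are zero. -/
def zerosF (b : Tm Γ baire) (n : Tm Γ Ty.nat) : Tm Γ Ty.omega :=
  Tm.all Ty.nat (ltF v0 n.wk ⇛ b.wk ⬝ v0 ≐ Tm.zero)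

/-- The formula stating that `n` is the first index with `b n ≠ 0`. -/
def firstF (b : Tm Γ baire) (n : Tm Γ Ty.nat) : Tm Γ Ty.omega :=
  zerosF b n ⋏ Tm.neg (b ⬝ n ≐ Tm.zero)

/-- The terms of `b` before `n` are zero. -/
def Zeros (c : M Ty.omega) (b : M baire) (n : M Ty.nat) : Prop :=
  ∀ i, ∀ d ≤ c, d ⊩ M.lt i n → d ⊩ M.eq (b ◃ i) M.zero

/-- The number `n` is the first index with `b n ≠ 0`. -/
def First (c : M Ty.omega) (b : M baire) (n : M Ty.nat) : Prop :=
  Zeros c b n ∧ c ⊮ M.eq (b ◃ n) M.zero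

@[simp] theorem forces_zerosF {b : Tm Γ baire} {n : Tm Γ Ty.nat} :
    c ⊩ ⟪zerosF b n⟫ ρ ↔ Zeros c (⟪b⟫ ρ) (⟪n⟫ ρ) := by
  simp [zerosF, Zeros]

@[simp] theorem forces_firstF {b : Tm Γ baire} {n : Tm Γ Ty.nat} :
    c ⊩ ⟪firstF b n⟫ ρ ↔ First c (⟪b⟫ ρ) (⟪n⟫ ρ) := by
  simp [firstF, First]

variable {b : M baire} {m n : M Ty.nat}

theorem Zeros.mono (h : Zeros c b n) (hd : d ≤ c) : Zeros d b n :=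
  fun i e he => h i e (he.trans hd)

theorem First.mono (h : First c b n) (hd : d ≤ c) : First d b n := ⟨h.1.mono hd, h.2.mono hd⟩

instance : Persistent fun c => First c b n := ⟨fun hd h => h.mono hd⟩

theorem zeros_zero : Zeros c b M.zero := fun _ _ _ h => forces_fls (forces_lt_zero h) _

theorem Zeros.succ (h : Zeros c b n) (h' : c ⊩ M.eq (b ◃ n) M.zero) : Zeros c b n.succ :=
  fun i _ hd hi => forces_lt_succ.1 hi _ fun e he hi => hi.elim (h i e (he.trans hd))
    fun hi => (hi.app_arg b).trans (h'.mono (he.trans hd))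

theorem Zeros.of_succ (h : Zeros c b n.succ) : Zeros c b n := fun i d hd hi => h i d hd (lt_succ hi)

theorem Zeros.last (h : Zeros c b n.succ) : c ⊩ M.eq (b ◃ n) M.zero :=
  h n c le_rfl (lt_succ_self c n)

/-- A bounded search, carried out by induction on the bound; equality with zero is decidable at each
step. -/
theorem zeros_or_first (c : M Ty.omega) (b : M baire) (k : M Ty.nat) :
    Loc c fun d => Zeros d b k ∨ ∃ n, First d b n := by
  have key := forces_induction (ρ := b ∷ Env.nil) (c := c)
    (zerosF v1 v0 ⋎ Tm.ex Ty.nat (firstF v2 v0)) ?_ ?_ k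
  · simp at key
    refine key.bind fun d _ h => ?_
    rcases h with h | h
    · exact .pure (.inl h)
    · exact h.imp fun _ _ h => .inr h
  · exact forces_or.2 (.pure (.inl (by simpa using zeros_zero)))
  · intro k d _ ih
    simp at ih ⊢
    refine ih.bind fun e he h => ?_
    rcases h with h | h
    · refine (nat_dec e (b ◃ k) M.zero).imp fun f hf h' => ?_
      rcases h' with h' | h'
      · exact .inl ((h.mono hf).succ h')
      · exact .inr (.pure ⟨k, h.mono hf, h'⟩)
    · exact .pure (.inr h)

theorem dec_zerosF {b : Tm Γ baire} {n : Tm Γ Ty.nat} : Dec c (⟪zerosF b n⟫ ρ) := by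
  have key := forces_induction (ρ := ⟪b⟫ ρ ∷ Env.nil) (c := c)
    (zerosF v1 v0 ⋎ Tm.neg (zerosF v1 v0)) ?_ ?_ (⟪n⟫ ρ)
  · simp at key
    simpa [Dec, Refutes] using key
  · exact forces_or.2 (.pure (.inl (by simpa using zeros_zero)))
  · intro k d _ ih
    simp [Refutes] at ih ⊢
    refine ih.bind fun e he h => ?_
    rcases h with h | h
    · refine (nat_dec e (⟪b⟫ ρ ◃ k) M.zero).imp fun f hf h' => ?_
      rcases h' with h' | h'
      · exact .inl ((h.mono hf).succ h')
      · exact .inr fun g hg hz => h' g hg hz.last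
    · exact .pure (.inr fun f hf hz => h f hf hz.of_succ)

theorem dec_firstF {b : Tm Γ baire} {n : Tm Γ Ty.nat} : Dec c (⟪firstF b n⟫ ρ) :=
  dec_zerosF.and (Dec.neg (by simpa using nat_dec c _ _))

theorem First.not_lt (h : First c b n) (hm : Zeros c b m) : c ⊮ M.lt n m :=
  fun d hd hl => h.2 d hd (hm n d hd hl)

theorem First.le (h : First c b n) (hm : Zeros c b m) :
    Loc c fun d => d ⊩ M.lt m n ∨ d ⊩ M.eq m n :=
  (lt_trichotomy c m n).bind fun d hd h' => by
    rcases h' with h' | h' | h'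
    · exact .pure (.inl h')
    · exact .pure (.inr h')
    · exact .of_fls (h.not_lt hm d hd h')

theorem First.unique (h : First c b n) (h' : First c b m) : c ⊩ M.eq n m :=
  h.le h'.1 _ fun d hd e => e.elim (fun e => forces_fls (h'.not_lt h.1 d hd e) _) (·.symm)

end

section

attribute [local simp] v0 v1 v2 v3 v4 forces_and forces_imp forces_all forces_ex forces_or
  forces_neg forces_iff forces_eq_refl

variable {Γ : Ctx} {A B : Ty} {c d : M Ty.omega} {ρ : Env Γ}

/-! ### Addition and pairing -/

/-- The recursion step in the definition of addition. -/
def addStep : Tm Γ (Ty.nat ⇾ Ty.nat ⇾ Ty.nat) := Tm.lam Ty.nat (Tm.lam Ty.nat (Tm.succ v0))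

/-- The term `s + t`. -/
def addF (s t : Tm Γ Ty.nat) : Tm Γ Ty.nat := Tm.natrec s addStep t

/-- Addition of natural numbers in the generic model. -/
noncomputable def M.add (m n : M Ty.nat) : M Ty.nat := M.natrec m (⟪addStep⟫ Env.nil) n

@[simp] theorem interp_addF (s t : Tm Γ Ty.nat) : ⟪addF s t⟫ ρ = M.add (⟪s⟫ ρ) (⟪t⟫ ρ) := by
  have h : ⟪addStep⟫ ρ = ⟪addStep⟫ Env.nil :=
    interp_const (Γ := Γ) addStep (fun _ x => nomatch x)
  simp [addF, M.add, h]

@[simp] theorem M.add_zero (m : M Ty.nat) : m.add M.zero = m := by simp [M.add]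

@[simp] theorem M.add_succ (m n : M Ty.nat) : m.add n.succ = (m.add n).succ := by
  simp [M.add, addStep]

theorem zero_add (c : M Ty.omega) (n : M Ty.nat) : c ⊩ M.eq (M.add M.zero n) n := by
  have key := forces_induction (ρ := Env.nil) (c := c) (addF Tm.zero v0 ≐ v0) ?_ ?_ n
  · simpa using key
  · simp
  · intro n d _ h
    simp at h ⊢
    exact h.succ

theorem succ_add (c : M Ty.omega) (m n : M Ty.nat) :
    c ⊩ M.eq (M.add m.succ n) (M.add m n).succ := by
  have key := forces_induction (ρ := m ∷ Env.nil) (c := c)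
    (addF (Tm.succ v1) v0 ≐ Tm.succ (addF v1 v0)) ?_ ?_ n
  · simpa using key
  · simp
  · intro n d _ h
    simp at h ⊢
    exact h.succ

/-- The step of the enumeration of pairs along antidiagonals. -/
def pairStep : Tm [] (Ty.nat ⇾ Ty.prod Ty.nat Ty.nat ⇾ Ty.prod Ty.nat Ty.nat) :=
  Tm.lam Ty.nat (Tm.lam (Ty.prod Ty.nat Ty.nat)
    (Tm.natrec (Tm.pair Tm.zero (Tm.succ (Tm.fst v0)))
      (Tm.lam Ty.nat (Tm.lam (Ty.prod Ty.nat Ty.nat) (Tm.pair (Tm.succ (Tm.fst v2)) v1)))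
      (Tm.snd v0)))

/-- An enumeration of the pairs of natural numbers. -/
noncomputable def M.unpair : M (Ty.nat ⇾ Ty.prod Ty.nat Ty.nat) :=
  ⟪Tm.lam Ty.nat (Tm.natrec (Tm.pair Tm.zero Tm.zero) v1 v0)⟫ (⟪pairStep⟫ Env.nil ∷ Env.nil)

theorem unpair_zero : M.unpair ◃ M.zero = M.pair M.zero M.zero := by simp [M.unpair]

theorem unpair_succ (j : M Ty.nat) :
    M.unpair ◃ j.succ = ⟪pairStep⟫ Env.nil ◃ j ◃ (M.unpair ◃ j) := by simp [M.unpair]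

theorem unpair_succ_of_zero {j m : M Ty.nat} (h : c ⊩ M.eq (M.unpair ◃ j) (M.pair m M.zero)) :
    c ⊩ M.eq (M.unpair ◃ j.succ) (M.pair M.zero m.succ) := by
  have h' := h.app_arg (⟪pairStep⟫ Env.nil ◃ j)
  rw [← unpair_succ] at h'
  simpa [pairStep] using h'

theorem unpair_succ_of_succ {j m n : M Ty.nat}
    (h : c ⊩ M.eq (M.unpair ◃ j) (M.pair m n.succ)) :
    c ⊩ M.eq (M.unpair ◃ j.succ) (M.pair m.succ n) := by
  have h' := h.app_arg (⟪pairStep⟫ Env.nil ◃ j)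
  rw [← unpair_succ] at h'
  simpa [pairStep] using h'

/-- Induction on the antidiagonal m + n, and inside it on m: the pair (0, s + 1) comes right after
(s, 0), and (m + 1, n) right after (m, n + 1). Only surjectivity of the enumeration is ever needed.
-/
theorem exists_unpair (c : M Ty.omega) (m n : M Ty.nat) :
    Loc c fun d => ∃ j, d ⊩ M.eq (M.unpair ◃ j) (M.pair m n) := by
  have key := forces_induction (ρ := M.unpair ∷ Env.nil) (c := c)
    (Tm.all Ty.nat (Tm.all Ty.nat (addF v1 v0 ≐ v2 ⇛
      Tm.ex Ty.nat (Tm.var (Var.there (Var.there (Var.there (Var.there Var.here)))) ⬝ v0 ≐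
        Tm.pair v2 v1)))) ?_ ?_ (m.add n)
  · simp at key
    exact key m n c le_rfl (forces_eq_refl _ _)
  · simp
    intro m n d _ h
    refine (nat_cases d n).bind fun e he hn => ?_
    rcases hn with hn | ⟨k, hn⟩
    · have h1 := hn.congr (ρ := m ∷ Env.nil) (addF v1 v0)
      simp at h1
      refine .pure ⟨M.zero, ?_⟩
      rw [unpair_zero]
      exact ((h1.symm.trans (h.mono he)).pair hn).symm
    · have h1 := hn.congr (ρ := m ∷ Env.nil) (addF v1 v0)
      simp at h1
      exact .of_fls (forces_succ_ne_zero (h1.symm.trans (h.mono he)))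
  · intro s d _ ih
    simp at ih ⊢
    intro m
    have inner := forces_induction (ρ := s ∷ M.unpair ∷ Env.nil) (c := d)
      (Tm.all Ty.nat (addF v1 v0 ≐ Tm.succ v2 ⇛ Tm.ex Ty.nat (v4 ⬝ v0 ≐ Tm.pair v2 v1)))
      ?_ ?_ m
    · simp at inner
      exact inner
    · simp
      intro n e he h
      have hn : e ⊩ M.eq s.succ n := h.symm.trans (zero_add e n)
      refine (ih s M.zero e he (by simp)).imp fun f hf ⟨j, hj⟩ => ⟨j.succ, ?_⟩
      exact (unpair_succ_of_zero hj).trans ((forces_eq_refl _ _).pair (hn.mono hf))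
    · intro m e he ih'
      simp at ih' ⊢
      intro n f hf h
      refine (ih' n.succ f hf (by simpa using (succ_add f m n).symm.trans h)).imp
        fun g hg ⟨j, hj⟩ => ⟨j.succ, unpair_succ_of_succ hj⟩

/-! ### Semidecidable truth values -/

/-- The sequence `f` takes the values zero and one only. -/
def Binary (c : M Ty.omega) (f : M baire) : Prop :=
  ∀ n, Loc c fun d => d ⊩ M.eq (f ◃ n) M.zero ∨ d ⊩ M.eq (f ◃ n) M.zero.succ

/-- The binary sequence `f` semidecides `p`. -/
def Semidecides (c : M Ty.omega) (f : M baire) (p : M Ty.omega) : Prop :=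
  Binary c f ∧ (∀ d ≤ c, d ⊩ p → Loc d fun e => ∃ n, e ⊩ M.eq (f ◃ n) M.zero.succ) ∧
    ∀ d ≤ c, (Loc d fun e => ∃ n, e ⊩ M.eq (f ◃ n) M.zero.succ) → d ⊩ p

/-- The truth value `p` is semidecidable. -/
def Semidec (c p : M Ty.omega) : Prop := Loc c fun d => ∃ f, Semidecides d f p

@[simp] theorem forces_isBinary {f : Tm Γ baire} : c ⊩ ⟪isBinary f⟫ ρ ↔ Binary c (⟪f⟫ ρ) := by
  simp [isBinary, Binary, Tm.one]

@[simp] theorem forces_isSemidec {p : Tm Γ Ty.omega} :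
    c ⊩ ⟪isSemidec p⟫ ρ ↔ Semidec c (⟪p⟫ ρ) := by
  simp [isSemidec, Semidec, Semidecides, Tm.one]

@[simp] theorem forces_isSemidecSet {S : Tm Γ (A ⇾ Ty.omega)} :
    c ⊩ ⟪isSemidecSet S⟫ ρ ↔ ∀ a, Semidec c (⟪S⟫ ρ ◃ a) := by
  simp [isSemidecSet]

@[simp] theorem forces_isSemidecOn {X S : Tm Γ (A ⇾ Ty.omega)} :
    c ⊩ ⟪isSemidecOn X S⟫ ρ ↔ ∀ a, ∀ d ≤ c, d ⊩ ⟪X⟫ ρ ◃ a → Semidec d (⟪S⟫ ρ ◃ a) := by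
  simp [isSemidecOn]

variable {p q : M Ty.omega}

theorem Binary.mono {f : M baire} (h : Binary c f) (hd : d ≤ c) : Binary d f :=
  fun n => (h n).mono hd

theorem Semidecides.mono {f : M baire} (h : Semidecides c f p) (hd : d ≤ c) :
    Semidecides d f p :=
  ⟨h.1.mono hd, fun e he => h.2.1 e (he.trans hd), fun e he => h.2.2 e (he.trans hd)⟩

instance {f : M baire} : Persistent fun c => Semidecides c f p := ⟨fun hd h => h.mono hd⟩

theorem Semidec.mono (h : Semidec c p) (hd : d ≤ c) : Semidec d p := Loc.mono h hd

theorem Semidec.congr (h : Semidec c p) (e : c ⊩ M.eq p q) : Semidec c q := by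
  have := e.subst (ρ := Env.nil) (isSemidec v0)
  simp at this
  exact this h

theorem Semidec.of_iff (h : Semidec c p) (hpq : ∀ d ≤ c, d ⊩ p → d ⊩ q)
    (hqp : ∀ d ≤ c, d ⊩ q → d ⊩ p) : Semidec c q :=
  h.congr (forces_prop_ext hpq hqp)

/-- The axioms of synthetic computability, with the instances of Dependent Choice that are used,
hold at the stage `c`. -/
structure Axioms (c : M Ty.omega) : Prop where
  dc_nat : c ⊩ ⟪dependentChoice (Ty.prod Ty.nat Ty.nat)⟫ Env.nil
  dc_baire : c ⊩ ⟪dependentChoice (Ty.prod Ty.nat baire)⟫ Env.nil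
  dc_baire' : c ⊩ ⟪dependentChoice (Ty.prod Ty.nat (Ty.nat ⇾ baire))⟫ Env.nil
  mp : c ⊩ ⟪markovPrinciple⟫ Env.nil
  enum : c ⊩ ⟪enumerability⟫ Env.nil
  stable : c ⊩ ⟪stableSubspace⟫ Env.nil

theorem Axioms.mono (h : Axioms c) (hd : d ≤ c) : Axioms d :=
  ⟨h.1.mono hd, h.2.mono hd, h.3.mono hd, h.4.mono hd, h.5.mono hd, h.6.mono hd⟩

theorem Axioms.markov (hc : Axioms c) {f : M baire} (hf : Binary c f)
    (h : ∀ d ≤ c, (∀ n, d ⊩ M.eq (f ◃ n) M.zero) → d ⊩ M.fls) :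
    Loc c fun d => ∃ n, d ⊩ M.eq (f ◃ n) M.zero.succ := by
  have h' := hc.mp
  simp [markovPrinciple, Tm.one] at h'
  refine h' f c le_rfl hf c le_rfl fun d hd hz => h d hd ?_
  simpa using hz

theorem Binary.ne_zero {f : M baire} (hf : Binary c f) {n : M Ty.nat}
    (h : c ⊮ M.eq (f ◃ n) M.zero) : c ⊩ M.eq (f ◃ n) M.zero.succ :=
  hf n _ fun d hd h' => h'.elim (fun h' => forces_fls (h d hd h') _) id

theorem Binary.exists_first {f : M baire} {n : M Ty.nat}
    (h : c ⊩ M.eq (f ◃ n) M.zero.succ) : Loc c fun d => ∃ m, First d f m :=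
  (zeros_or_first c f n.succ).imp fun d hd h' => by
    rcases h' with h' | h'
    · exact ⟨n, h'.of_succ, fun e he h0 =>
        forces_succ_ne_zero (((h.mono hd).mono he).symm.trans h0)⟩
    · exact h'

/-- Countable choice collects the decisions into a characteristic sequence, with value one where the
predicate holds and zero where it is refuted. -/
theorem Axioms.semidec_of_exists (hc : Axioms c) (P : Tm (Ty.nat :: Γ) Ty.omega)
    (hP : ∀ n, Dec c (⟪P⟫ (n ∷ ρ)))
    (h : ∀ d ≤ c, d ⊩ p → Loc d fun e => ∃ n, e ⊩ ⟪P⟫ (n ∷ ρ))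
    (h' : ∀ d ≤ c, ∀ n, d ⊩ ⟪P⟫ (n ∷ ρ) → d ⊩ p) : Semidec c p := by
  have hf := countable_choice hc.dc_nat (⟪Tm.lam Ty.nat (Tm.lam Ty.nat
    (P.wk ⋏ v0 ≐ Tm.one ⋎ Tm.neg P.wk ⋏ v0 ≐ Tm.zero))⟫ ρ) fun n => (hP n).imp fun d _ hd => by
      rcases hd with hd | hd
      · refine ⟨M.zero.succ, ?_⟩
        simp only [interp_lam_app]
        exact forces_or.2 (.pure (.inl (by simpa [Tm.one] using hd)))
      · refine ⟨M.zero, ?_⟩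
        simp only [interp_lam_app]
        exact forces_or.2 (.pure (.inr (by simpa using hd)))
  refine hf.imp fun d hd ⟨f, hf⟩ => ⟨f, fun n => ?_, fun e he hp => ?_, fun e he hn => ?_⟩
  · have hn := hf n
    simp only [interp_lam_app] at hn
    refine (forces_or.1 hn).imp fun e _ h => ?_
    simp [Tm.one] at h
    exact h.elim (fun h => .inr h.2) fun h => .inl h.2
  · refine (h e (he.trans hd) hp).bind fun g hg ⟨n, hn⟩ => ?_
    have hfn := (hf n).mono (hg.trans he)
    simp only [interp_lam_app] at hfn
    refine (forces_or.1 hfn).imp fun e he h => ⟨n, ?_⟩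
    simp [Tm.one] at h
    exact h.elim (fun h => h.2) fun h => h.1.elim (hn.mono he) _
  · refine hn _ fun g hg ⟨n, hn⟩ => ?_
    have hfn := (hf n).mono (hg.trans he)
    simp only [interp_lam_app] at hfn
    refine forces_or.1 hfn _ fun i hi h => ?_
    simp [Tm.one] at h
    rcases h with h | h
    · exact h' i (hi.trans (hg.trans (he.trans hd))) n h.1
    · exact forces_fls (forces_succ_ne_zero ((hn.mono hi).symm.trans h.2)) _

theorem Axioms.semidec_of_dec (hc : Axioms c) (h : Dec c p) : Semidec c p :=
  hc.semidec_of_exists (Γ := [Ty.omega]) (ρ := p ∷ Env.nil) v1 (fun n => by simpa using h)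
    (fun d _ hp => .pure ⟨M.zero, by simpa using hp⟩) fun d _ n hp => by simpa using hp

theorem Axioms.semidec_of_exists₂ (hc : Axioms c) (P : M (Ty.nat ⇾ Ty.nat ⇾ Ty.omega))
    (hP : ∀ m n, Dec c (P ◃ m ◃ n))
    (h : ∀ d ≤ c, d ⊩ p → Loc d fun e => ∃ m n, e ⊩ P ◃ m ◃ n)
    (h' : ∀ d ≤ c, ∀ m n, d ⊩ P ◃ m ◃ n → d ⊩ p) : Semidec c p := by
  refine hc.semidec_of_exists (ρ := M.unpair ∷ P ∷ Env.nil)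
    (v2 ⬝ Tm.fst (v1 ⬝ v0) ⬝ Tm.snd (v1 ⬝ v0)) (fun n => by simpa using hP _ _)
    (fun d hd hp => ?_) fun d hd n hn => h' d hd _ _ (by simpa using hn)
  refine (h d hd hp).bind fun e he ⟨m, n, hmn⟩ => (exists_unpair e m n).imp fun f hf ⟨j, hj⟩ => ?_
  refine ⟨j, ?_⟩
  have h1 := hj.fst
  have h2 := hj.snd
  simp at h1 h2 ⊢
  exact ((h1.app_arg P).app_fun _).eq_mpr ((h2.app_arg _).eq_mpr (hmn.mono hf))

end

section

attribute [local simp] v0 v1 v2 v3 v4 forces_and forces_imp forces_all forces_ex forces_or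
  forces_neg forces_iff forces_eq_refl

variable {Γ : Ctx} {A B : Ty} {c d : M Ty.omega} {ρ : Env Γ}

/-! ### Enumerating the semidecidable binary relations -/

/-- The formula stating that the binary sequence `f` semidecides `p`. -/
def semidecidesF (f : Tm Γ baire) (p : Tm Γ Ty.omega) : Tm Γ Ty.omega :=
  isBinary f ⋏ Tm.iff p (Tm.ex Ty.nat (f.wk ⬝ v0 ≐ Tm.one))

@[simp] theorem forces_semidecidesF {f : Tm Γ baire} {p : Tm Γ Ty.omega} :
    c ⊩ ⟪semidecidesF f p⟫ ρ ↔ Semidecides c (⟪f⟫ ρ) (⟪p⟫ ρ) := by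
  simp [semidecidesF, Semidecides, Tm.one]

variable {Q : M (Ty.nat ⇾ Ty.nat ⇾ baire)} {val : M baire} {k : M Ty.nat} {U : M powNN}

/-- The `k`-th relation listed by `Q` and `val` is `U`: the pairs `(n, m)` in `U` are those with
`Q k n s = 1` and `val s = m` for some `s`. -/
def Lists (c : M Ty.omega) (Q : M (Ty.nat ⇾ Ty.nat ⇾ baire)) (val : M baire) (k : M Ty.nat)
    (U : M powNN) : Prop :=
  ∀ n m, (∀ d ≤ c, d ⊩ U ◃ M.pair n m →
      Loc d fun e => ∃ s, e ⊩ M.eq (Q ◃ k ◃ n ◃ s) M.zero.succ ∧ e ⊩ M.eq (val ◃ s) m) ∧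
    ∀ d ≤ c, (Loc d fun e => ∃ s, e ⊩ M.eq (Q ◃ k ◃ n ◃ s) M.zero.succ ∧
      e ⊩ M.eq (val ◃ s) m) → d ⊩ U ◃ M.pair n m

/-- The formula for `Lists`. -/
def listsF (Q : Tm Γ (Ty.nat ⇾ Ty.nat ⇾ baire)) (val : Tm Γ baire) (k : Tm Γ Ty.nat)
    (U : Tm Γ powNN) : Tm Γ Ty.omega :=
  Tm.all Ty.nat (Tm.all Ty.nat (Tm.iff (U.wk.wk ⬝ Tm.pair v1 v0)
    (Tm.ex Ty.nat (Q.wk.wk.wk ⬝ k.wk.wk.wk ⬝ v2 ⬝ v0 ≐ Tm.one ⋏ val.wk.wk.wk ⬝ v0 ≐ v1))))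

@[simp] theorem forces_listsF {Q : Tm Γ (Ty.nat ⇾ Ty.nat ⇾ baire)} {val : Tm Γ baire}
    {k : Tm Γ Ty.nat} {U : Tm Γ powNN} :
    c ⊩ ⟪listsF Q val k U⟫ ρ ↔ Lists c (⟪Q⟫ ρ) (⟪val⟫ ρ) (⟪k⟫ ρ) (⟪U⟫ ρ) := by
  simp [listsF, Lists, Tm.one]

/-- Every semidecidable relation is listed by `Q` and `val`. -/
structure Enumerates (c : M Ty.omega) (Q : M (Ty.nat ⇾ Ty.nat ⇾ baire)) (val : M baire) :
    Prop where
  binary : ∀ k n, Binary c (Q ◃ k ◃ n)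
  surj : ∀ U : M powNN, ∀ d ≤ c, (∀ x, Semidec d (U ◃ x)) → Loc d fun e => ∃ k, Lists e Q val k U

theorem Enumerates.mono (h : Enumerates c Q val) (hd : d ≤ c) : Enumerates d Q val :=
  ⟨fun k n => (h.1 k n).mono hd, fun U e he => h.2 U e (he.trans hd)⟩

theorem Axioms.exists_surjection (hc : Axioms c) :
    Loc c fun d => ∃ W : M (Ty.nat ⇾ Ty.nat ⇾ Ty.omega), (∀ k n, Semidec d (W ◃ k ◃ n)) ∧
      ∀ S, ∀ e ≤ d, (∀ n, Semidec e (S ◃ n)) → Loc e fun f => ∃ k, f ⊩ M.eq (W ◃ k) S := by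
  have h := hc.enum
  simpa [enumerability] using h

/-- Countable choice is used twice: for fixed k it chooses a sequence for each n, then it chooses
these families along k. The second use chooses elements of type `Ty.nat ⇾ baire`. -/
theorem Axioms.exists_semidecides (hc : Axioms c) (W : M (Ty.nat ⇾ Ty.nat ⇾ Ty.omega))
    (hW : ∀ k n, Semidec c (W ◃ k ◃ n)) :
    Loc c fun d => ∃ F : M (Ty.nat ⇾ Ty.nat ⇾ baire),
      ∀ k n, Semidecides d (F ◃ k ◃ n) (W ◃ k ◃ n) := by
  have h := countable_choice hc.dc_baire' (⟪Tm.lam Ty.nat (Tm.lam (Ty.nat ⇾ baire)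
    (Tm.all Ty.nat (semidecidesF (v1 ⬝ v0) (v3 ⬝ v2 ⬝ v0))))⟫ (W ∷ Env.nil)) fun k => by
      have h := countable_choice hc.dc_baire (⟪Tm.lam Ty.nat (Tm.lam baire
        (semidecidesF v0 (v2 ⬝ v1)))⟫ (W ◃ k ∷ Env.nil)) fun n =>
          (hW k n).imp fun d _ ⟨f, hf⟩ => ⟨f, by simpa using hf⟩
      exact h.imp fun d _ ⟨f, hf⟩ => ⟨f, by simpa using hf⟩
  exact h.imp fun d _ ⟨F, hF⟩ => ⟨F, by simpa using hF⟩

theorem Axioms.exists_code (hc : Axioms c) :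
    Loc c fun d => ∃ g : M (Ty.nat ⇾ baire),
      ∀ m n, d ⊩ M.eq (M.unpair ◃ (g ◃ m ◃ n)) (M.pair m n) := by
  have h := countable_choice hc.dc_baire (⟪Tm.lam Ty.nat (Tm.lam baire
    (Tm.all Ty.nat (v3 ⬝ (v1 ⬝ v0) ≐ Tm.pair v2 v0)))⟫ (M.unpair ∷ Env.nil)) fun m => by
      have h := countable_choice hc.dc_nat (⟪Tm.lam Ty.nat (Tm.lam Ty.nat
        (v2 ⬝ v0 ≐ Tm.pair v3 v1))⟫ (M.unpair ∷ m ∷ Env.nil)) fun n =>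
          (exists_unpair c m n).imp fun d _ ⟨f, hf⟩ => ⟨f, by simpa using hf⟩
      exact h.imp fun d _ ⟨f, hf⟩ => ⟨f, by simpa using hf⟩
  exact h.imp fun d _ ⟨F, hF⟩ => ⟨F, by simpa using hF⟩

/-- A position s codes a time t and a candidate value m: `Q k n s` is the t-th term of the sequence
semideciding whether the code of (n, m) lies in W(k), and `val s` is m. Thus `val` depends neither
on k nor on n. -/
theorem Axioms.exists_enumerates (hc : Axioms c) :
    Loc c fun d => ∃ Q val, Enumerates d Q val := by
  refine hc.exists_surjection.bind fun d hd ⟨W, hW, hW'⟩ => ?_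
  refine ((hc.mono hd).exists_semidecides W hW).bind fun e he ⟨F, hF⟩ => ?_
  refine ((hc.mono (he.trans hd)).exists_code).imp fun f hf ⟨g, hg⟩ => ?_
  refine ⟨⟪Tm.lam Ty.nat (Tm.lam Ty.nat (Tm.lam Ty.nat
    (Tm.var (Var.there (Var.there (Var.there (Var.there (Var.there Var.here))))) ⬝ v2 ⬝
      (v3 ⬝ v1 ⬝ Tm.snd (v4 ⬝ v0)) ⬝ Tm.fst (v4 ⬝ v0))))⟫ (g ∷ M.unpair ∷ F ∷ Env.nil),
    ⟪Tm.lam Ty.nat (Tm.snd (v1 ⬝ v0))⟫ (M.unpair ∷ Env.nil), fun k n s => ?_,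
    fun U i hi hU => ?_⟩
  · have := ((hF k (g ◃ n ◃ M.snd (M.unpair ◃ s))).1.mono hf) (M.fst (M.unpair ◃ s))
    simpa using this
  · refine (hW' (⟪Tm.lam Ty.nat (v1 ⬝ (v2 ⬝ v0))⟫ (U ∷ M.unpair ∷ Env.nil)) i
      (hi.trans hf |>.trans he) fun n => by simpa using hU _).imp fun j hj ⟨k, hk⟩ => ⟨k, ?_⟩
    intro n m
    have hjf : j ≤ f := hj.trans hi
    have hg' := (hg n m).mono hjf
    have hE : j ⊩ M.eq (W ◃ k ◃ (g ◃ n ◃ m)) (U ◃ M.pair n m) := by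
      have := hk.app_fun (g ◃ n ◃ m)
      simp at this
      exact this.trans (hg'.app_arg U)
    have hS := (hF k (g ◃ n ◃ m)).mono (hjf.trans hf)
    constructor
    · intro l hl hUl
      refine (hS.2.1 l hl ((hE.mono hl).eq_mpr hUl)).bind fun l' hl' ⟨t, ht⟩ => ?_
      refine (exists_unpair l' t m).imp fun o ho ⟨s, hs⟩ => ⟨s, ?_⟩
      have h1 := hs.fst
      have h2 := hs.snd
      simp at h1 h2 ⊢
      refine ⟨?_, h2⟩
      exact ((((h2.app_arg (g ◃ n)).app_arg (F ◃ k)).app_fun _).trans (h1.app_arg _)).trans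
        (ht.mono ho)
    · intro l hl h
      refine h _ fun o ho ⟨s, hs, hv⟩ => (hE.mono (ho.trans hl)).eq_mp
        (hS.2.2 o (ho.trans hl) (.pure ⟨M.fst (M.unpair ◃ s), ?_⟩))
      simp at hs hv
      exact (((hv.app_arg (g ◃ n)).app_arg (F ◃ k)).app_fun _).symm.trans hs

/-- Cantor's diagonal: the set of n outside W(n) would be semidecidable, hence equal to some W(k),
and k would belong to it exactly when it does not. -/
theorem Axioms.not_semidec_neg (hc : Axioms c)
    (h : ∀ p, ∀ d ≤ c, Semidec d p → Semidec d (⟪Tm.neg v0⟫ (p ∷ Env.nil))) : c ⊩ M.fls := by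
  refine hc.exists_surjection _ fun d hd ⟨W, hW, hW'⟩ => ?_
  refine hW' (⟪Tm.lam Ty.nat (Tm.neg (v1 ⬝ v0 ⬝ v0))⟫ (W ∷ Env.nil)) d le_rfl (fun n => ?_) _
    fun e he ⟨k, hk⟩ => ?_
  · refine (h _ d hd (hW n n)).of_iff ?_ ?_ <;> simp
  · have hE := hk.app_fun k
    simp only [interp_lam_app] at hE
    have hn : e ⊮ W ◃ k ◃ k := fun f hf hw => by
      have := (hE.mono hf).eq_mp hw
      simp at this
      exact this f le_rfl hw
    exact hn e le_rfl (hE.eq_mpr (by simpa using hn))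

/-! ### Indices of sequences -/

/-- The graph map of the generic model. -/
noncomputable def M.graph : M (baire ⇾ powNN) := ⟪graphMap⟫ Env.nil

theorem forces_graph {a : M baire} {x : M (Ty.prod Ty.nat Ty.nat)} :
    c ⊩ M.graph ◃ a ◃ x ↔ c ⊩ M.eq x.snd (a ◃ x.fst) := by
  simp [M.graph, graphMap]
  constructor
  · refine fun h => h _ fun d hd ⟨n, hn⟩ => ?_
    have h1 := hn.fst
    have h2 := hn.snd
    simp at h1 h2
    exact h2.trans (h1.app_arg a).symm
  · intro h
    refine .pure ⟨x.fst, ?_⟩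
    have := (forces_eq_refl c x.fst).pair h
    simpa using this

theorem Axioms.semidec_graph (hc : Axioms c) (a : M baire) (x : M (Ty.prod Ty.nat Ty.nat)) :
    Semidec c (M.graph ◃ a ◃ x) :=
  hc.semidec_of_dec ((nat_dec c x.snd (a ◃ x.fst)).imp fun _ _ h =>
    h.imp forces_graph.2 fun h e he hx => h e he (forces_graph.1 hx))

/-- The relation with index `k` is the graph of `a`. -/
def Index (c : M Ty.omega) (Q : M (Ty.nat ⇾ Ty.nat ⇾ baire)) (val : M baire) (k : M Ty.nat)
    (a : M baire) : Prop :=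
  ∀ n, (Loc c fun d => ∃ s, d ⊩ M.eq (Q ◃ k ◃ n ◃ s) M.zero.succ) ∧
    ∀ s, ∀ d ≤ c, d ⊩ M.eq (Q ◃ k ◃ n ◃ s) M.zero.succ → d ⊩ M.eq (val ◃ s) (a ◃ n)

/-- The formula for `Index`. -/
def indexF (Q : Tm Γ (Ty.nat ⇾ Ty.nat ⇾ baire)) (val : Tm Γ baire) (k : Tm Γ Ty.nat)
    (a : Tm Γ baire) : Tm Γ Ty.omega :=
  Tm.all Ty.nat (Tm.ex Ty.nat (Q.wk.wk ⬝ k.wk.wk ⬝ v1 ⬝ v0 ≐ Tm.one) ⋏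
    Tm.all Ty.nat (Q.wk.wk ⬝ k.wk.wk ⬝ v1 ⬝ v0 ≐ Tm.one ⇛ val.wk.wk ⬝ v0 ≐ a.wk.wk ⬝ v1))

@[simp] theorem forces_indexF {Q : Tm Γ (Ty.nat ⇾ Ty.nat ⇾ baire)} {val : Tm Γ baire}
    {k : Tm Γ Ty.nat} {a : Tm Γ baire} :
    c ⊩ ⟪indexF Q val k a⟫ ρ ↔ Index c (⟪Q⟫ ρ) (⟪val⟫ ρ) (⟪k⟫ ρ) (⟪a⟫ ρ) := by
  simp [indexF, Index, Tm.one]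

variable {a b : M baire}

theorem Index.mono (h : Index c Q val k a) (hd : d ≤ c) : Index d Q val k a :=
  fun n => ⟨(h n).1.mono hd, fun s e he => (h n).2 s e (he.trans hd)⟩

theorem Index.unique (h : Index c Q val k a) (h' : Index c Q val k b) : c ⊩ M.eq a b :=
  forces_fun_ext fun n => (h n).1 _ fun d hd ⟨s, hs⟩ =>
    ((h n).2 s d hd hs).symm.trans ((h' n).2 s d hd hs)

theorem Lists.index (h : Lists c Q val k (M.graph ◃ a)) : Index c Q val k a := by
  simp only [Lists, forces_graph, M.fst_pair, M.snd_pair] at h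
  refine fun n => ⟨?_, fun s d hd hs => ?_⟩
  · exact ((h n (a ◃ n)).1 c le_rfl (forces_eq_refl _ _)).imp fun d _ ⟨s, hs, _⟩ => ⟨s, hs⟩
  · exact (h n (val ◃ s)).2 d hd (.pure ⟨s, hs, forces_eq_refl _ _⟩)

theorem Enumerates.exists_index (hQ : Enumerates c Q val) (hc : Axioms c) (a : M baire) :
    Loc c fun d => ∃ k, Index d Q val k a :=
  (hQ.surj _ c le_rfl (hc.semidec_graph a)).imp fun _ _ ⟨k, hk⟩ => ⟨k, hk.index⟩

/-- The property of having a sequence as its relation is stable under double negation. -/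
theorem Enumerates.index_stable (hQ : Enumerates c Q val) (hc : Axioms c)
    (h : ∀ d ≤ c, (∀ e ≤ d, ∀ a, Index e Q val k a → e ⊩ M.fls) → d ⊩ M.fls) :
    Loc c fun d => ∃ a, Index d Q val k a := by
  have hs := countable_choice hc.dc_nat
    (⟪Tm.lam Ty.nat (Tm.lam Ty.nat (v2 ⬝ v1 ⬝ v0 ≐ Tm.one))⟫ (Q ◃ k ∷ Env.nil)) fun n => by
      -- The relation is, up to double negation, the graph of a sequence, so the search at `n`
      -- cannot fail everywhere; Markov's principle then finds a position.
      refine (hc.markov (hQ.binary k n) fun d hd hz => ?_).imp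
        fun d _ ⟨s, hs⟩ => ⟨s, by simpa [Tm.one] using hs⟩
      refine h d hd fun e he a ha => (ha n).1 _ fun f hf ⟨s, hs⟩ => ?_
      exact forces_succ_ne_zero (hs.symm.trans ((hz s).mono (hf.trans he)))
  refine hs.imp fun d hd ⟨s, hs⟩ =>
    ⟨⟪Tm.lam Ty.nat (v1 ⬝ (v2 ⬝ v0))⟫ (val ∷ s ∷ Env.nil), fun n => ⟨.pure ⟨s ◃ n, ?_⟩, ?_⟩⟩
  · simpa [Tm.one] using hs n
  · intro t e he ht
    simp
    -- Equality of numbers is decidable, hence stable, so single-valuedness may be checked while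
    -- assuming that the relation is the graph of some `b`.
    refine (nat_dec e _ _).stable fun f hf hne => ?_
    refine h f (hf.trans (he.trans hd)) fun g hg b hb => hne g hg ?_
    have h1 := (hs n).mono (hg.trans (hf.trans he))
    simp [Tm.one] at h1
    exact ((hb n).2 t g le_rfl (ht.mono (hg.trans hf))).trans ((hb n).2 _ g le_rfl h1).symm

theorem Axioms.stable_subspace (hc : Axioms c) (X S : M (Ty.nat ⇾ Ty.omega))
    (hX : ∀ n, ∀ d ≤ c, (∀ e ≤ d, e ⊮ X ◃ n → e ⊩ M.fls) → d ⊩ X ◃ n)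
    (hS : ∀ n, ∀ d ≤ c, d ⊩ X ◃ n → Semidec d (S ◃ n)) :
    Loc c fun d => ∃ T : M (Ty.nat ⇾ Ty.omega), (∀ n, Semidec d (T ◃ n)) ∧
      ∀ n, ∀ e ≤ d, e ⊩ X ◃ n → e ⊩ M.eq (T ◃ n) (S ◃ n) := by
  have h := hc.stable
  simp [stableSubspace] at h
  refine (h X c le_rfl (fun n d hd hn => hX n d hd fun e he h => hn e he ?_) S c le_rfl hS).imp
    fun d hd ⟨T, hT, hT'⟩ => ⟨T, hT, fun n e he hx => ?_⟩
  · exact forces_neg.2 (by simpa using h)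
  · exact forces_prop_ext (hT' n e he hx).1 (hT' n e he hx).2

/-- S is transported to indices as "some a with index k satisfies S". On the stable set of indices
of sequences this has the truth value of S at the unique such a, hence is semidecidable, and the
Stable Subspace Axiom applies. -/
theorem Enumerates.exists_extension (hQ : Enumerates c Q val) (hc : Axioms c)
    (S : M (baire ⇾ Ty.omega)) (hS : ∀ a, Semidec c (S ◃ a)) :
    Loc c fun d => ∃ T : M (Ty.nat ⇾ Ty.omega), (∀ k, Semidec d (T ◃ k)) ∧
      ∀ k a, ∀ e ≤ d, Index e Q val k a → e ⊩ M.eq (T ◃ k) (S ◃ a) := by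
  have key : ∀ k a, ∀ d ≤ c, Index d Q val k a → d ⊩ M.eq
      (⟪Tm.lam Ty.nat (Tm.ex baire (indexF v2 v3 v1 v0 ⋏ v4 ⬝ v0))⟫ (Q ∷ val ∷ S ∷ Env.nil) ◃ k)
      (S ◃ a) := by
    intro k a d hd h
    refine forces_prop_ext (fun e he hs => ?_) fun e he hs => ?_
    · simp at hs
      exact hs _ fun f hf ⟨b, hb, hs⟩ =>
        ((hb.unique (h.mono (hf.trans he))).app_arg S).eq_mp hs
    · simp
      exact .pure ⟨a, h.mono he, hs⟩
  refine (hc.stable_subspace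
    (⟪Tm.lam Ty.nat (Tm.ex baire (indexF v2 v3 v1 v0))⟫ (Q ∷ val ∷ Env.nil))
    (⟪Tm.lam Ty.nat (Tm.ex baire (indexF v2 v3 v1 v0 ⋏ v4 ⬝ v0))⟫ (Q ∷ val ∷ S ∷ Env.nil))
    (fun k d hd h => ?_) fun k d hd h => ?_).imp fun d hd ⟨T, hT, hT'⟩ => ⟨T, hT, ?_⟩
  · simp at h ⊢
    refine (hQ.mono hd).index_stable (hc.mono hd) fun e he h' => h e he fun f hf hx => ?_
    simp at hx
    exact hx _ fun g hg ⟨a, ha⟩ => h' g (hg.trans hf) a ha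
  · simp only [interp_lam_app, forces_ex] at h
    exact Loc.bind h fun e he ⟨a, ha⟩ => ((hS a).mono (he.trans hd)).congr
      (key k a e (he.trans hd) (by simpa using ha)).symm
  · intro k a e he h
    exact (hT' k e he (by simpa using Loc.pure ⟨a, h⟩)).trans (key k a e (he.trans hd) h)

end

section

attribute [local simp] v0 v1 v2 v3 v4 forces_and forces_imp forces_all forces_ex forces_or
  forces_neg forces_iff forces_eq_refl

variable {Γ : Ctx} {A B : Ty} {c d : M Ty.omega} {ρ : Env Γ}

/-! ### The graph map is a weak intrinsic inclusion -/

@[simp] theorem forces_sigmaNN {U : M powNN} :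
    c ⊩ ⟪sigmaNN⟫ Env.nil ◃ U ↔ ∀ x, Semidec c (U ◃ x) := by
  simp [sigmaNN]

theorem graph_injective {a b : M baire} (h : c ⊩ M.eq (M.graph ◃ a) (M.graph ◃ b)) :
    c ⊩ M.eq a b :=
  forces_fun_ext fun n => by
    have h1 : c ⊩ M.graph ◃ a ◃ M.pair n (a ◃ n) :=
      forces_graph.2 (by simp)
    simpa using forces_graph.1 ((h.app_fun _).eq_mp h1)

theorem Axioms.forces_isInjectionInto (hc : Axioms c) :
    c ⊩ ⟪isInjectionInto sigmaNN graphMap⟫ Env.nil := by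
  simp [isInjectionInto]
  exact ⟨hc.semidec_graph, fun a b d _ h => graph_injective h⟩

theorem Axioms.forces_isWeakIntrinsicInclusion (hc : Axioms c) :
    c ⊩ ⟪isWeakIntrinsicInclusion sigmaNN graphMap⟫ Env.nil := by
  rw [isWeakIntrinsicInclusion, forces_and]
  refine ⟨hc.forces_isInjectionInto, ?_⟩
  simp [isMultivaluedSemidec]
  intro S d hd hS
  replace hc := hc.mono hd
  refine hc.exists_enumerates.bind fun e he ⟨Q, val, hQ⟩ => ?_
  refine (hQ.exists_extension (hc.mono he) S fun a => (hS a).mono he).imp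
    fun f hf ⟨T, hT, hTS⟩ => ?_
  -- The values at U are the truth values T(k) for all k that list U. Different indices may give
  -- different values unless U is a graph.
  refine ⟨⟪Tm.lam powNN (Tm.lam Ty.omega (Tm.ex Ty.nat
    (listsF v3 v4 v0 v2 ⋏ v1 ≐ Tm.var (Var.there (Var.there (Var.there (Var.there
      (Var.there Var.here))))) ⬝ v0)))⟫ (Q ∷ val ∷ T ∷ Env.nil), ?_, ?_⟩
  · intro U g hg hU
    simp
    refine ⟨fun p h hh hp => ?_, ?_⟩
    · exact Loc.bind hp fun i hi ⟨k, _, hk⟩ => ((hT k).mono (hi.trans (hh.trans hg))).congr hk.symm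
    · refine (hQ.surj U g (hg.trans hf) hU).imp fun h hh ⟨k, hk⟩ => ⟨T ◃ k, .pure ⟨k, hk, ?_⟩⟩
      simp
  · intro a p
    simp
    refine ⟨fun g hg h => ?_, fun g hg h => ?_⟩
    · exact h _ fun i hi ⟨k, hk, hp⟩ => hp.trans (hTS k a i (hi.trans hg) hk.index)
    · refine (hQ.surj (M.graph ◃ a) g (hg.trans hf)
        ((hc.mono (hg.trans (hf.trans he))).semidec_graph a)).imp fun i hi ⟨k, hk⟩ => ⟨k, hk, ?_⟩
      exact (h.mono hi).trans (hTS k a i (hi.trans hg) hk.index).symm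

end

section

attribute [local simp] v0 v1 v2 v3 v4 forces_and forces_imp forces_all forces_ex forces_or
  forces_neg forces_iff forces_eq_refl

variable {Γ : Ctx} {A B : Ty} {c d : M Ty.omega} {ρ : Env Γ}
  {Q : M (Ty.nat ⇾ Ty.nat ⇾ baire)} {val : M baire} {a b : M baire} {j k l m n : M Ty.nat}

/-! ### Friedberg's semidecidable set of sequences -/

/-- The partial function with index `k` agrees with `a` at the argument `n + 1 + k`. -/
def Agrees (c : M Ty.omega) (Q : M (Ty.nat ⇾ Ty.nat ⇾ baire)) (val a : M baire)
    (n k : M Ty.nat) : Prop :=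
  Loc c fun d => ∃ s, First d (Q ◃ k ◃ M.add n.succ k) s ∧
    d ⊩ M.eq (val ◃ s) (a ◃ M.add n.succ k)

/-- The formula for `Agrees`. -/
def agreesF (Q : Tm Γ (Ty.nat ⇾ Ty.nat ⇾ baire)) (val a : Tm Γ baire) (n k : Tm Γ Ty.nat) :
    Tm Γ Ty.omega :=
  Tm.ex Ty.nat (firstF (Q.wk ⬝ k.wk ⬝ addF (Tm.succ n.wk) k.wk) v0 ⋏
    val.wk ⬝ v0 ≐ a.wk ⬝ addF (Tm.succ n.wk) k.wk)

@[simp] theorem forces_agreesF {Q : Tm Γ (Ty.nat ⇾ Ty.nat ⇾ baire)} {val a : Tm Γ baire}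
    {n k : Tm Γ Ty.nat} :
    c ⊩ ⟪agreesF Q val a n k⟫ ρ ↔ Agrees c (⟪Q⟫ ρ) (⟪val⟫ ρ) (⟪a⟫ ρ) (⟪n⟫ ρ) (⟪k⟫ ρ) := by
  simp [agreesF, Agrees]

/-- The set of sequences `a` that are zero before some `k` such that, if `a` is nonzero for the
first time at `n`, then the partial function with index `k` agrees with `a` at `n + 1 + k`. -/
noncomputable def friedberg (Q : M (Ty.nat ⇾ Ty.nat ⇾ baire)) (val : M baire) :
    M (baire ⇾ Ty.omega) :=
  ⟪Tm.lam baire (Tm.ex Ty.nat (zerosF v1 v0 ⋏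
    Tm.all Ty.nat (firstF v2 v0 ⇛ agreesF v3 v4 v2 v0 v1)))⟫ (Q ∷ val ∷ Env.nil)

theorem forces_friedberg : c ⊩ friedberg Q val ◃ a ↔
    Loc c fun d => ∃ k, Zeros d a k ∧ ∀ n, ∀ e ≤ d, First e a n → Agrees e Q val a n k := by
  simp [friedberg]

theorem friedberg_zero (h : ∀ n, c ⊩ M.eq (a ◃ n) M.zero) : c ⊩ friedberg Q val ◃ a :=
  forces_friedberg.2 (.pure ⟨M.zero, zeros_zero, fun n d hd hn =>
    .of_fls (hn.2 d le_rfl ((h n).mono hd))⟩)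

theorem Agrees.mono (h : Agrees c Q val a n k) (hd : d ≤ c) : Agrees d Q val a n k :=
  Loc.mono h hd

/-- An index of a witnesses agreement everywhere. Reading a partial function at the first successful
position makes it single-valued for arbitrary indices; for an index of a, every successful position
gives the same value. -/
theorem Index.agrees (h : Index c Q val k a) (hQ : Enumerates c Q val) (n : M Ty.nat) :
    Agrees c Q val a n k :=
  (h (M.add n.succ k)).1.bind fun _ hd ⟨_, hs⟩ =>
    (Binary.exists_first hs).imp fun e he ⟨t, ht⟩ => ⟨t, ht, (h _).2 t e (he.trans hd)
      (((hQ.binary _ _).mono (he.trans hd)).ne_zero ht.2)⟩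

theorem Enumerates.semidec_friedberg (hQ : Enumerates c Q val) (hc : Axioms c) (a : M baire) :
    Semidec c (friedberg Q val ◃ a) := by
  refine Loc.bind (hQ.exists_index hc a) fun d hd ⟨k, hk⟩ => ?_
  refine (zeros_or_first d a k).bind fun e he h => ?_
  have hce := hc.mono (he.trans hd)
  have hQe := hQ.mono (he.trans hd)
  rcases h with h | ⟨n, hn⟩
  -- The index `k` itself is the witness, so membership holds outright.
  · exact hce.semidec_of_dec (.of_forces (forces_friedberg.2 (.pure ⟨k, h, fun n f hf _ =>
      (hk.mono (hf.trans he)).agrees (hQe.mono hf) n⟩)))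
  -- With the first nonzero place `n` known, the condition on all first nonzero places reduces to a
  -- search for `k` and a position `s`.
  · refine hce.semidec_of_exists₂ (⟪Tm.lam Ty.nat (Tm.lam Ty.nat (zerosF v2 v1 ⋏
      firstF (v3 ⬝ v1 ⬝ addF (Tm.succ v4) v1) v0 ⋏
      Tm.var (Var.there (Var.there (Var.there (Var.there (Var.there Var.here))))) ⬝ v0 ≐
        v2 ⬝ addF (Tm.succ v4) v1))⟫ (a ∷ Q ∷ n ∷ val ∷ Env.nil))
      (fun k s => ?_) (fun f hf h => ?_) fun f hf k s h => ?_
    · simp only [interp_lam_app]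
      exact dec_zerosF.and (dec_firstF.and (by simpa using nat_dec e _ _))
    · refine (forces_friedberg.1 h).bind fun g hg ⟨k, hk, h⟩ => ?_
      refine (h n g le_rfl (hn.mono (hg.trans hf))).imp fun i hi ⟨s, hs, hv⟩ => ⟨k, s, ?_⟩
      simp
      exact ⟨hk.mono hi, hs, hv⟩
    · simp at h
      refine forces_friedberg.2 (.pure ⟨k, h.1, fun m g hg hm => ?_⟩)
      have e := (hn.mono (hg.trans hf)).unique hm
      have := e.subst (ρ := Q ∷ val ∷ a ∷ k ∷ Env.nil) (agreesF v1 v2 v3 v0 v4)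
      simp at this
      exact this (.pure ⟨s, h.2.1.mono hg, h.2.2.mono hg⟩)

theorem lt_succ_add (c : M Ty.omega) (n l : M Ty.nat) : c ⊩ M.lt n (M.add n.succ l) := by
  have key := forces_induction (ρ := n ∷ Env.nil) (c := c)
    (ltF v1 (addF (Tm.succ v1) v0)) ?_ ?_ l
  · simpa using key
  · simpa using lt_succ_self c n
  · intro l d _ h
    simp at h ⊢
    exact lt_succ h

theorem add_lt_add (m : M Ty.nat) (h : c ⊩ M.lt j l) : c ⊩ M.lt (m.add j) (m.add l) := by
  have key := forces_induction (ρ := j ∷ m ∷ Env.nil) (c := c)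
    (ltF v1 v0 ⇛ ltF (addF v2 v1) (addF v2 v0)) ?_ ?_ l
  · simp at key
    exact key c le_rfl h
  · simp
    exact fun d _ h => forces_fls (forces_lt_zero h) _
  · intro l d _ ih
    simp at ih ⊢
    intro e he h
    refine forces_lt_succ.1 h _ fun f hf h => ?_
    rcases h with h | h
    · exact lt_succ (ih f (hf.trans he) h)
    · have := h.congr (ρ := m ∷ Env.nil) (addF v1 v0)
      simp at this
      exact lt_congr_left (lt_succ_self f _) this.symm

theorem ne_of_lt (h : c ⊩ M.lt m n) : c ⊮ M.eq m n :=
  fun d hd e => lt_irrefl d n d le_rfl (lt_congr_left (h.mono hd) e)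

theorem Axioms.exists_update (hc : Axioms c) (a : M baire) (m n : M Ty.nat) :
    Loc c fun d => ∃ b, d ⊩ M.eq (b ◃ m) n ∧
      ∀ i, ∀ e ≤ d, e ⊮ M.eq i m → e ⊩ M.eq (b ◃ i) (a ◃ i) := by
  refine (countable_choice hc.dc_nat (⟪Tm.lam Ty.nat (Tm.lam Ty.nat
    (v1 ≐ v2 ⋏ v0 ≐ v3 ⋎ Tm.neg (v1 ≐ v2) ⋏ v0 ≐ v4 ⬝ v1))⟫ (m ∷ n ∷ a ∷ Env.nil))
    fun i => ?_).imp fun d _ ⟨b, hb⟩ => ⟨b, ?_, fun i e he hi => ?_⟩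
  · refine (nat_dec c i m).imp fun d _ h => ?_
    rcases h with h | h
    · refine ⟨n, ?_⟩
      simp only [interp_lam_app]
      exact forces_or.2 (.pure (.inl (by simpa using h)))
    · refine ⟨a ◃ i, ?_⟩
      simp only [interp_lam_app]
      exact forces_or.2 (.pure (.inr (by simpa using h)))
  · have h := hb m
    simp only [interp_lam_app] at h
    refine forces_or.1 h _ fun e he h => ?_
    simp at h
    exact h.elim id fun h => h.1.elim (forces_eq_refl _ _) _
  · have h := (hb i).mono he
    simp only [interp_lam_app] at h
    refine forces_or.1 h _ fun f hf h => ?_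
    simp at h
    exact h.elim (fun h => (hi.mono hf).elim h.1 _) fun h => h.2

/-- The sequence `a` is nonzero for the first time at `n`, and it disagrees with the partial
functions with index below `l`. -/
def Diagonal (c : M Ty.omega) (Q : M (Ty.nat ⇾ Ty.nat ⇾ baire)) (val a : M baire)
    (n l : M Ty.nat) : Prop :=
  Zeros c a n ∧ c ⊩ M.eq (a ◃ n) M.zero.succ ∧
    ∀ j, ∀ d ≤ c, d ⊩ M.lt j l → ∀ e ≤ d, Agrees e Q val a n j → e ⊩ M.fls

/-- The formula for `Diagonal`. -/
def diagonalF (Q : Tm Γ (Ty.nat ⇾ Ty.nat ⇾ baire)) (val a : Tm Γ baire) (n l : Tm Γ Ty.nat) :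
    Tm Γ Ty.omega :=
  zerosF a n ⋏ a ⬝ n ≐ Tm.one ⋏
    Tm.all Ty.nat (ltF v0 l.wk ⇛ Tm.neg (agreesF Q.wk val.wk a.wk n.wk v0))

@[simp] theorem forces_diagonalF {Q : Tm Γ (Ty.nat ⇾ Ty.nat ⇾ baire)} {val a : Tm Γ baire}
    {n l : Tm Γ Ty.nat} : c ⊩ ⟪diagonalF Q val a n l⟫ ρ ↔
      Diagonal c (⟪Q⟫ ρ) (⟪val⟫ ρ) (⟪a⟫ ρ) (⟪n⟫ ρ) (⟪l⟫ ρ) := by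
  simp [diagonalF, Diagonal, Tm.one, Refutes]

theorem Diagonal.mono (h : Diagonal c Q val a n l) (hd : d ≤ c) : Diagonal d Q val a n l :=
  ⟨h.1.mono hd, h.2.1.mono hd, fun j e he => h.2.2 j e (he.trans hd)⟩

/-- Whether a partial function is defined at an argument is not decidable, but up to double negation
some number i differs from its value: if zero does not, the value exists, and its successor does. -/
theorem forces_fls_of_avoid (val : M baire)
    (h : ∀ d ≤ c, ∀ i : M Ty.nat,
      (∀ e ≤ d, ∀ s, First e a s → e ⊩ M.eq (val ◃ s) i → e ⊩ M.fls) → d ⊩ M.fls) :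
    c ⊩ M.fls := by
  refine h c le_rfl M.zero fun d hd s hs _ => h d hd (val ◃ s).succ fun e he t ht hv => ?_
  exact forces_ne_succ_self _ e le_rfl ((((hs.mono he).unique ht).app_arg val).trans hv)

theorem Axioms.diagonal_zero (hc : Axioms c) (Q : M (Ty.nat ⇾ Ty.nat ⇾ baire)) (val : M baire)
    (n : M Ty.nat) : Loc c fun d => ∃ a, Diagonal d Q val a n M.zero := by
  refine (hc.exists_update (⟪Tm.lam Ty.nat Tm.zero⟫ Env.nil) n M.zero.succ).imp
    fun d _ ⟨b, hn, hb⟩ => ⟨b, fun i e he hi => ?_, hn, fun j e he hj => ?_⟩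
  · simpa using hb i e he (ne_of_lt hi)
  · exact fun f hf _ => (forces_lt_zero hj).mono hf

/-- Only the term at n + 1 + l is changed, to a number avoided by the l-th partial function. This
place lies beyond n and differs from n + 1 + j for j < l, so everything achieved before is
preserved. -/
theorem Axioms.diagonal_succ (hc : Axioms c) (ha : Diagonal c Q val a n l)
    (h : ∀ d ≤ c, ∀ b, Diagonal d Q val b n l.succ → d ⊩ M.fls) : c ⊩ M.fls := by
  refine forces_fls_of_avoid (a := Q ◃ l ◃ M.add n.succ l) val fun d hd i hi => ?_
  refine (hc.mono hd).exists_update a (M.add n.succ l) i _ fun e he ⟨b, hbi, hb⟩ => ?_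
  have ha := ha.mono (he.trans hd)
  refine h e (he.trans hd) b ⟨fun j f hf hj => ?_, ?_, fun j f hf hj g hg hag => ?_⟩
  · exact (hb j f hf (ne_of_lt (lt_trans hj (lt_succ_add f n l)))).trans (ha.1 j f hf hj)
  · exact (hb n e le_rfl (ne_of_lt (lt_succ_add e n l))).trans ha.2.1
  · refine (forces_lt_succ.1 hj).mono hg _ fun o ho hj => ?_
    have hoe := ho.trans (hg.trans hf)
    rcases hj with hj | hj
    · refine ha.2.2 j o hoe hj o le_rfl ((hag.mono ho).imp fun r hr ⟨s, hs, hv⟩ => ⟨s, hs, ?_⟩)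
      exact hv.trans (hb _ r (hr.trans hoe) (ne_of_lt (add_lt_add _ (hj.mono hr))))
    · have := hj.subst (ρ := Q ∷ val ∷ b ∷ n ∷ Env.nil) (agreesF v1 v2 v3 v4 v0)
      simp at this
      refine this (hag.mono ho) _ fun r hr ⟨s, hs, hv⟩ => ?_
      exact hi r (hr.trans (hoe.trans he)) s hs (hv.trans (hbi.mono (hr.trans hoe)))

/-- Each step supplies the next term only up to double negation, so the induction runs on the doubly
negated existence statement. -/
theorem Axioms.exists_diagonal (hc : Axioms c) (Q : M (Ty.nat ⇾ Ty.nat ⇾ baire)) (val : M baire)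
    (n l : M Ty.nat) (h : ∀ d ≤ c, ∀ a, Diagonal d Q val a n l → d ⊩ M.fls) : c ⊩ M.fls := by
  have key := forces_induction (ρ := Q ∷ val ∷ n ∷ Env.nil) (c := c)
    (Tm.neg (Tm.neg (Tm.ex baire (diagonalF v2 v3 v0 v4 v1)))) ?_ ?_ l
  · simp only [forces_neg] at key
    refine key c le_rfl (forces_neg.2 fun d hd h' => ?_)
    simp at h'
    exact h' _ fun e he ⟨a, ha⟩ => h e (he.trans hd) a ha
  · refine forces_neg.2 fun d hd h => forces_neg.1 h d le_rfl ?_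
    simpa using (hc.mono hd).diagonal_zero Q val n
  · intro l d hd ih
    refine forces_neg.2 fun e he h => forces_neg.1 ih e he (forces_neg.2 fun f hf h' => ?_)
    simp at h'
    refine h' _ fun g hg ⟨a, ha⟩ => (hc.mono (hg.trans (hf.trans (he.trans hd)))).diagonal_succ ha
      fun i hi b hb => forces_neg.1 h i (hi.trans (hg.trans hf)) ?_
    simpa using Loc.pure ⟨b, hb⟩

/-- Every finite segment of the zero sequence has an extension outside of Friedberg's set. -/
theorem Axioms.exists_not_friedberg (hc : Axioms c) (Q : M (Ty.nat ⇾ Ty.nat ⇾ baire))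
    (val : M baire) (n : M Ty.nat)
    (h : ∀ d ≤ c, ∀ a, Zeros d a n → d ⊮ friedberg Q val ◃ a → d ⊩ M.fls) : c ⊩ M.fls := by
  -- A witness `k` for membership satisfies `k ≤ n`, since `a` is zero before `k` but not at `n`; it
  -- suffices to diagonalize against the indices below `n + 1`.
  refine hc.exists_diagonal Q val n n.succ fun d hd a ha => h d hd a ha.1 fun e he hf => ?_
  refine forces_friedberg.1 hf _ fun f hf ⟨k, hk, hag⟩ => ?_
  have ha := ha.mono (hf.trans he)
  have hn : First f a n :=
    ⟨ha.1, fun g hg h0 => forces_succ_ne_zero ((ha.2.1.mono hg).symm.trans h0)⟩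
  refine hn.le hk _ fun g hg hkn => ha.2.2 k g hg (forces_lt_succ.2 (.pure hkn)) g le_rfl ?_
  exact hag n g hg (hn.mono hg)

/-! ### The graph map is not an intrinsic inclusion -/

variable {T : M (powNN ⇾ Ty.omega)}

/-- A semidecidable property of semidecidable relations is upward closed. -/
theorem Axioms.upward_closed (hc : Axioms c)
    (hT : ∀ U, ∀ d ≤ c, (∀ x, Semidec d (U ◃ x)) → Semidec d (T ◃ U)) {U V : M powNN}
    (hU : ∀ x, Dec c (U ◃ x)) (hV : ∀ x, Dec c (V ◃ x))
    (hUV : ∀ x, ∀ d ≤ c, d ⊩ U ◃ x → d ⊩ V ◃ x) (h : c ⊩ T ◃ U) (h' : c ⊮ T ◃ V) :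
    c ⊩ M.fls := by
  refine hc.not_semidec_neg fun p d hd hp => ?_
  -- The relation U ∪ {x ∈ V | p} is semidecidable because U and V are decidable. It equals V if p
  -- holds and U if p fails, so T holds of it exactly when p fails.
  have hVp := hT (⟪Tm.lam (Ty.prod Ty.nat Ty.nat) (v1 ⬝ v0 ⋎ v3 ⋏ v2 ⬝ v0)⟫
    (U ∷ V ∷ p ∷ Env.nil)) d hd fun x => Loc.bind ((hU x).mono hd) fun e he hUx => by
      rcases hUx with hUx | hUx
      · refine (hc.mono (he.trans hd)).semidec_of_dec (.of_forces ?_)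
        simpa using Loc.pure (P := fun e => e ⊩ U ◃ x ∨ _) (.inl hUx)
      · refine Loc.bind ((hV x).mono (he.trans hd)) fun f hf hVx => ?_
        have hcf := hc.mono (hf.trans (he.trans hd))
        rcases hVx with hVx | hVx
        · refine (hp.mono (hf.trans he)).of_iff (fun g hg hp => ?_) fun g hg hx => ?_
          · simpa using Loc.pure (P := fun e => _ ∨ e ⊩ p ∧ e ⊩ V ◃ x) (.inr ⟨hp, hVx.mono hg⟩)
          · simp at hx
            exact hx _ fun i hi hx => hx.elim
              (fun hx => (hUx.mono (hi.trans (hg.trans hf))).elim hx _) And.left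
        · refine hcf.semidec_of_dec (.of_refutes fun g hg hx => ?_)
          simp at hx
          exact hx _ fun i hi hx => hx.elim (hUx i (hi.trans (hg.trans hf)))
            fun hx => hVx i (hi.trans hg) hx.2
  refine hVp.of_iff (fun e he ht => forces_neg.2 fun f hf hp => ?_) fun e he hn => ?_
  · simp at hp
    refine h' f (hf.trans (he.trans hd)) (Forces.eq_mp (Forces.app_arg ?_ T) (ht.mono hf))
    refine forces_fun_ext fun x => ?_
    simp only [interp_lam_app]
    refine forces_prop_ext (fun g hg hx => ?_) fun g hg hx => ?_
    · simp at hx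
      exact hx _ fun i hi hx => hx.elim
        (hUV x i (hi.trans (hg.trans (hf.trans (he.trans hd))))) And.right
    · simpa using Loc.pure (P := fun e => _ ∨ e ⊩ p ∧ e ⊩ V ◃ x) (.inr ⟨hp.mono hg, hx⟩)
  · simp at hn
    refine Forces.eq_mpr (Forces.app_arg ?_ T) (h.mono (he.trans hd))
    refine forces_fun_ext fun x => ?_
    simp only [interp_lam_app]
    refine forces_prop_ext (fun g hg hx => ?_) fun g hg hx => ?_
    · simp at hx
      exact hx _ fun i hi hx => hx.elim id
        fun hx => (hn.mono (hi.trans hg)).elim hx.1 _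
    · simpa using Loc.pure (P := fun e => e ⊩ U ◃ x ∨ _) (.inl hx)

theorem Enumerates.not_extends_friedberg (hc : Axioms c)
    (hT : ∀ U, ∀ d ≤ c, (∀ x, Semidec d (U ◃ x)) → Semidec d (T ◃ U))
    (hTF : ∀ a, c ⊩ M.eq (T ◃ (M.graph ◃ a)) (friedberg Q val ◃ a)) : c ⊩ M.fls := by
  refine hc.not_semidec_neg fun p d hd hp => ?_
  refine Loc.bind hp fun e he ⟨f, hf⟩ => ?_
  have hce := hc.mono (he.trans hd)
  -- The successor includes the place itself: (x, 0) belongs to U when f vanishes through x. If f is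
  -- first nonzero at m, then U is the zero segment of length m.
  have hU : ∀ x, Dec e (⟪Tm.lam (Ty.prod Ty.nat Ty.nat)
      (Tm.snd v0 ≐ Tm.zero ⋏ zerosF v1 (Tm.succ (Tm.fst v0)))⟫ (f ∷ Env.nil) ◃ x) := by
    intro x
    simp only [interp_lam_app]
    exact Dec.and (by simpa using nat_dec e _ _) dec_zerosF
  refine (hT _ e (he.trans hd) fun x => hce.semidec_of_dec (hU x)).of_iff
    (fun g hg ht => forces_neg.2 fun i hi hp => ?_) fun g hg hn => ?_
  · simp at hp
    refine hf.2.1 i (hi.trans hg) hp _ fun o ho ⟨n, hn⟩ => ?_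
    refine Binary.exists_first hn _ fun r hr ⟨m, hm⟩ => ?_
    have hre := hr.trans (ho.trans (hi.trans hg))
    -- The extension outside F exists only up to double negation, which suffices as the goal is
    -- falsity.
    refine (hce.mono hre).exists_not_friedberg Q val m fun u hu a ha hna => ?_
    have huc := hu.trans (hre.trans (he.trans hd))
    refine (hc.mono huc).upward_closed (fun U v hv => hT U v (hv.trans huc))
      (U := _) (V := M.graph ◃ a) (fun x => (hU x).mono (hu.trans hre)) (fun x => ?_)
      (fun x v hv hx => ?_) (ht.mono (hu.trans (hr.trans (ho.trans hi)))) fun v hv ht => ?_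
    · exact (nat_dec u x.snd (a ◃ x.fst)).imp fun _ _ h =>
        h.imp forces_graph.2 fun h e he hx => h e he (forces_graph.1 hx)
    · simp at hx
      refine (hm.mono (hv.trans hu)).le hx.2 _ fun w hw h => ?_
      have hlt : w ⊩ M.lt x.fst m := h.elim (lt_trans (lt_succ_self w _))
        (lt_congr_right (lt_succ_self w _))
      exact forces_graph.2 ((hx.1.mono hw).trans (ha _ w (hw.trans hv) hlt).symm)
    · exact hna v hv (((hTF a).mono (hv.trans huc)).eq_mp ht)
  · simp at hn
    have h0 : ∀ n, g ⊩ M.eq (f ◃ n) M.zero := fun n => (hf.1 n).mono hg _ fun i hi h =>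
      h.elim id fun h => (hn.mono hi).elim (hf.2.2 i (hi.trans hg) (.pure ⟨n, h⟩)) _
    -- If p fails, f is identically zero and U is the graph of the zero sequence, which belongs to
    -- F.
    have hz := ((hTF (⟪Tm.lam Ty.nat Tm.zero⟫ Env.nil)).mono (hg.trans (he.trans hd))).eq_mpr
      (friedberg_zero fun n => by simp)
    refine Forces.eq_mpr (Forces.app_arg (forces_fun_ext fun x => forces_prop_ext
      (fun i hi hx => ?_) fun i hi hx => ?_) T) hz
    · simp at hx
      exact forces_graph.2 (by simpa using hx.1)
    · have hx := forces_graph.1 hx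
      simp at hx ⊢
      exact ⟨hx, fun n o ho _ => (h0 n).mono (ho.trans hi)⟩

theorem Axioms.refutes_isIntrinsicInclusion (hc : Axioms c) :
    c ⊮ ⟪isIntrinsicInclusion sigmaNN graphMap⟫ Env.nil := by
  intro d hd h
  replace hc := hc.mono hd
  rw [isIntrinsicInclusion, forces_and] at h
  have h := h.2
  simp at h
  refine hc.exists_enumerates _ fun e he ⟨Q, val, hQ⟩ => ?_
  refine h (friedberg Q val) e he (hQ.semidec_friedberg (hc.mono he)) _ fun f hf ⟨T, hT, hTF⟩ => ?_
  exact Enumerates.not_extends_friedberg (hc.mono (hf.trans he)) hT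
    fun a => forces_prop_ext (hTF a).1 (hTF a).2

end

end SynthComp

theorem mainTheorem12 :
    SynthComp.Provable SynthComp.SyntheticComputability
      (SynthComp.Tm.and
        (SynthComp.isWeakIntrinsicInclusion SynthComp.sigmaNN SynthComp.graphMap)
        (SynthComp.Tm.neg (SynthComp.isIntrinsicInclusion SynthComp.sigmaNN SynthComp.graphMap))) := by
  open SynthComp in
  -- Countable choice is needed for numbers, sequences, and sequences of sequences, which accounts
  -- for the three instances of Dependent Choice.
  refine ⟨[dependentChoice (Ty.prod Ty.nat Ty.nat), dependentChoice (Ty.prod Ty.nat baire),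
    dependentChoice (Ty.prod Ty.nat (Ty.nat ⇾ baire)), markovPrinciple, enumerability,
    stableSubspace], ?_, derives_of_forces fun c h => ?_⟩
  · simp only [List.mem_cons, List.not_mem_nil, or_false]
    rintro h (rfl | rfl | rfl | rfl | rfl | rfl)
    exacts [.dependentChoice _, .dependentChoice _, .dependentChoice _, .markovPrinciple,
      .enumerability, .stableSubspace]
  · have hc : Axioms c := ⟨h _ (by simp), h _ (by simp), h _ (by simp), h _ (by simp),
      h _ (by simp), h _ (by simp)⟩
    exact forces_and.2 ⟨hc.forces_isWeakIntrinsicInclusion,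
      forces_neg.2 hc.refutes_isIntrinsicInclusion⟩
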